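/- **Conventions.** An $n$-dimensional *matchbox manifold* is a compact connected metrizable space $\mathfrak M$ with a smooth foliated atlas: it is covered by charts $U\cong(-1,1)^n\times T$, with $U$ open and $T$ compact and totally disconnected, whose transition maps are $C^\infty$ along the plaques with all leafwise derivatives continuous. Its *leaves* are its path components, each with the leaf topology (generated by the path components of the open subsets of $\mathfrak M$). A *presentation* is a sequence $\mathcal P=\{p_{\ell+1}:M_{\ell+1}\to M_\ell\mid \ell\ge 0\}$ of covering maps of finite degree $>1$ between compact connected $n$-manifolds without boundary, and $\mathcal S_{\mathcal P}=\varprojlim M_\ell$ is the associated *weak solenoid*. Put $q_\ell=p_1\circ\cdots\circ p_\ell:M_\ell\to M_0$. For $x=(x_\ell)\in\mathcal S_{\mathcal P}$ the *group chain* at $x$ is $G_\ell=(q_\ell)_\#\pi_1(M_\ell,x_\ell)\subseteq G_0=\pi_1(M_0,x_0)$, its *cores* are $C_\ell=\bigcap_{g\in G_0}gG_\ell g^{-1}$, and the *discriminant group* is $\mathcal D_x=\varprojlim G_\ell/C_\ell$, with the inverse limit topology of the discrete groups $G_\ell/C_\ell$. **Theorem.** Let $\mathfrak M$ be an $n$-dimensional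 matchbox manifold, let $\mathcal P$ be a presentation by $n$-manifolds with a homeomorphism $h:\mathfrak M\to\mathcal S_{\mathcal P}$ (in particular, $\mathfrak M$ is equicontinuous; conversely, every equicontinuous matchbox manifold is homeomorphic to a weak solenoid), and let $x\in\mathcal S_{\mathcal P}$. Then: 1. $\mathcal D_x$ is a compact, Hausdorff, totally disconnected topological group. 2. There are a sequence of covering maps $\hat p_{\ell+1}:\widehat M_{\ell+1}\to\widehat M_\ell$ ($\ell\ge0$) between compact connected $n$-manifolds without boundary, a point $z=(z_\ell)\in\varprojlim\widehat M_\ell$, and covering maps $r_\ell:\widehat M_\ell\to M_\ell$ with $r_\ell\circ\hat p_{\ell+1}=p_{\ell+1}\circ r_{\ell+1}$ and $r_\ell(z_\ell)=x_\ell$, such that $\hat q_\ell=q_\ell\circ r_\ell:\widehat M_\ell\to M_0$ is the normal covering attached to the core $C_\ell$, that is, $(\hat q_\ell)_\#\pi_1(\widehat M_\ell,z_\ell)=C_\ell$ for all $\ell\geq 0$. 3. The *Molino space* $\widehat{\mathfrak M}=\varprojlim\widehat M_\ell$ of this sequence is an $n$-dimensional matchbox manifold, and it is homogeneous: for any two of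 its points some homeomorphism of $\widehat{\mathfrak M}$ takes one to the other. 4. The continuous map $\hat q:\widehat{\mathfrak M}\to\mathfrak M$ induced by the maps $r_\ell$ (so that the $\ell$-th coordinate of $h(\hat q(w))$ is $r_\ell(w_\ell)$ for all $w\in\widehat{\mathfrak M}$ and $\ell\ge0$) is a principal $\mathcal D_x$-bundle $$\mathcal D_x\longrightarrow\widehat{\mathfrak M}\stackrel{\hat q}{\longrightarrow}\mathfrak M ,$$ that is, for some continuous fibre-preserving action of $\mathcal D_x$ on $\widehat{\mathfrak M}$ it is locally trivial, by trivializations with fibre $\mathcal D_x$ that turn the action into translation in $\mathcal D_x$. 5. For every leaf $\widehat L$ of $\widehat{\mathfrak M}$ there is a leaf $L$ of $\mathfrak M$ such that $\hat q$ restricts to a surjective covering map $\widehat L\to L$. -/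

import Mathlib

open scoped ContDiff

universe u

/-! ### Matchbox manifolds and their leaves -/

/-- A foliation chart of dimension `n` on `X`: a homeomorphism from an open subset of `X` onto
`(-1,1)^n × T`, where the local transverse model `T` is compact and totally disconnected. (In a
compact metrizable space, covering by such open charts is the same as covering by the interiors of
closed charts `[-1,1]^n × T`, as one sees by shrinking and rescaling the cube.) -/
structure FoliationChart (n : ℕ) (X : Type u) [TopologicalSpace X] where
  /-- The local transverse model. -/
  T : Type u
  [topologicalSpace : TopologicalSpace T]
  [compactSpace : CompactSpace T]
  [totallyDisconnectedSpace : TotallyDisconnectedSpace T]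
  /-- The coordinate map. -/
  chart : OpenPartialHomeomorph X (EuclideanSpace ℝ (Fin n) × T)
  target_eq : chart.target = {v | ∀ i, v i ∈ Set.Ioo (-1 : ℝ) 1} ×ˢ Set.univ

attribute [instance] FoliationChart.topologicalSpace FoliationChart.compactSpace
  FoliationChart.totallyDisconnectedSpace

namespace FoliationChart

variable {n : ℕ} {X : Type u} [TopologicalSpace X]

/-- The domain of the change of coordinates from `c` to `c'`. -/
def overlap (c c' : FoliationChart n X) : Set (EuclideanSpace ℝ (Fin n) × c.T) :=
  (c.chart.symm.trans c'.chart).source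

/-- The leaf component of the change of coordinates from `c` to `c'`. -/
def leafTransition (c c' : FoliationChart n X) (z : EuclideanSpace ℝ (Fin n) × c.T) :
    EuclideanSpace ℝ (Fin n) :=
  (c'.chart (c.chart.symm z)).1

/-- The change of coordinates from `c` to `c'` is `C^∞` along the plaques, and all its leafwise
derivatives depend continuously on the point, in particular on the transverse parameter. -/
structure SmoothTransition (c c' : FoliationChart n X) : Prop where
  contDiffOn : ∀ t : c.T,
    ContDiffOn ℝ ∞ (fun v => c.leafTransition c' (v, t)) {v | (v, t) ∈ c.overlap c'}
  continuousOn : ∀ k : ℕ,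
    ContinuousOn (fun z : EuclideanSpace ℝ (Fin n) × c.T =>
      iteratedFDeriv ℝ k (fun v => c.leafTransition c' (v, z.2)) z.1) (c.overlap c')

end FoliationChart

/-- `X` is a (smooth) `n`-dimensional matchbox manifold: a compact connected metrizable space that
is covered by smoothly compatible foliation charts with totally disconnected transversals. -/
structure IsMatchboxManifold (n : ℕ) (X : Type u) [TopologicalSpace X] : Prop where
  compactSpace : CompactSpace X
  connectedSpace : ConnectedSpace X
  metrizableSpace : TopologicalSpace.MetrizableSpace X
  exists_atlas : ∃ A : Set (FoliationChart n X),
    (∀ x, ∃ c ∈ A, x ∈ c.chart.source) ∧ ∀ c ∈ A, ∀ c' ∈ A, c.SmoothTransition c'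

/-- Any two points are exchanged by a homeomorphism of the space. -/
def IsHomogeneousSpace (X : Type u) [TopologicalSpace X] : Prop :=
  ∀ x y : X, ∃ f : X ≃ₜ X, f x = y

/-- The leaf topology on a foliated space `X`, generated by the path components of the open subsets
of `X`. For a matchbox manifold it is generated by the open subsets of the plaques of the charts,
because the path components of `(-1,1)^n × T` are the sets `(-1,1)^n × {t}`. -/
@[reducible]
def leafTopology (X : Type u) [TopologicalSpace X] : TopologicalSpace X :=
  TopologicalSpace.generateFrom {s | ∃ U : Set X, IsOpen U ∧ ∃ x ∈ U, s = pathComponentIn U x}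

/-- The leaf through `x`: the path component of `x`, with the leaf topology (not with the coarser
topology induced from `X`). -/
def Leaf {X : Type u} [TopologicalSpace X] (x : X) : Type u :=
  {y : X // y ∈ pathComponent x}

instance {X : Type u} [TopologicalSpace X] (x : X) : TopologicalSpace (Leaf x) :=
  (leafTopology X).induced Subtype.val

/-- The restriction of a continuous map to the leaf through `x`, as a map to the leaf through the
image of `x`. -/
def leafMap {X Y : Type u} [TopologicalSpace X] [TopologicalSpace Y] (q : C(X, Y)) (x : X) :
    Leaf x → Leaf (q x) :=
  fun y => ⟨q y.1, Joined.map y.2 q.continuous⟩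

/-! ### Towers of coverings and weak solenoids -/

/-- A compact connected `n`-dimensional topological manifold without boundary. -/
structure IsClosedManifold (n : ℕ) (X : Type u) [TopologicalSpace X] : Prop where
  compactSpace : CompactSpace X
  connectedSpace : ConnectedSpace X
  t2Space : T2Space X
  chartedSpace : Nonempty (ChartedSpace (EuclideanSpace ℝ (Fin n)) X)

/-- A sequence of covering maps `M 0 ← M 1 ← M 2 ← ⋯` between closed connected `n`-manifolds. -/
structure CoveringTower (n : ℕ) where
  /-- The manifolds. -/
  M : ℕ → Type u
  [topologicalSpace : ∀ l, TopologicalSpace (M l)]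
  isClosedManifold : ∀ l, IsClosedManifold n (M l)
  /-- The bonding maps. -/
  p : ∀ l, C(M (l + 1), M l)
  isCoveringMap : ∀ l, IsCoveringMap (p l)

attribute [instance] CoveringTower.topologicalSpace

namespace CoveringTower

variable {n : ℕ} (P : CoveringTower.{u} n)

/-- The inverse limit of the tower, as a subspace of the product. -/
def Limit : Type u :=
  {x : ∀ l, P.M l // ∀ l, P.p l (x (l + 1)) = x l}

instance : TopologicalSpace P.Limit :=
  inferInstanceAs (TopologicalSpace {x : ∀ l, P.M l // ∀ l, P.p l (x (l + 1)) = x l})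

variable {P} in
/-- The `l`-th coordinate of a point of the inverse limit. -/
def Limit.coord (x : P.Limit) (l : ℕ) : P.M l :=
  x.1 l

/-- The composed covering `M l → M 0`. -/
def q : ∀ l, C(P.M l, P.M 0)
  | 0 => ContinuousMap.id _
  | l + 1 => (q l).comp (P.p l)

theorem q_coord (x : P.Limit) (l : ℕ) : P.q l (x.coord l) = x.coord 0 := by
  induction l with
  | zero => rfl
  | succ l ih =>
    have h : P.p l (x.coord (l + 1)) = x.coord l := x.2 l
    rw [q, ContinuousMap.comp_apply, h, ih]

/-- The group chain at `x`: the images of `π₁(M l, x l)` in `π₁(M 0, x 0)`. -/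
noncomputable def groupChain (x : P.Limit) (l : ℕ) :
    Subgroup (FundamentalGroup (P.M 0) (x.coord 0)) :=
  (FundamentalGroup.mapOfEq (P.q l) (P.q_coord x l)).range

end CoveringTower

/-- A presentation of a weak solenoid: a tower of coverings of closed connected manifolds, each of
finite degree `> 1`. The weak solenoid that it defines is its inverse limit. -/
structure Presentation (n : ℕ) extends CoveringTower.{u} n where
  one_lt_degree : ∀ l, ∃ m : ℕ, 1 < m ∧ ∀ y, Nat.card (p l ⁻¹' {y}) = m

/-! ### The discriminant group of a group chain -/

section Discriminant

variable {Γ : Type u} [Group Γ]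

/-- For a descending chain `G` of subgroups of `Γ` with cores `C l`: the inverse limit of the groups
`Γ ⧸ C l`, i.e. the sequences of cosets in which the coset modulo `C (l + 1)` is sent to the coset
modulo `C l` by the canonical projection `g C (l + 1) ↦ g C l`. -/
def coreLimit (G : ℕ → Subgroup Γ) : Subgroup (∀ l, Γ ⧸ (G l).normalCore) where
  carrier := {c | ∀ l, ∃ g : Γ,
    c (l + 1) = (g : Γ ⧸ (G (l + 1)).normalCore) ∧ c l = (g : Γ ⧸ (G l).normalCore)}
  mul_mem' := by
    intro a b ha hb l
    obtain ⟨g, hg, hg'⟩ := ha l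
    obtain ⟨k, hk, hk'⟩ := hb l
    exact ⟨g * k, by simp [hg, hk], by simp [hg', hk']⟩
  one_mem' := fun l => ⟨1, by simp, by simp⟩
  inv_mem' := by
    intro a ha l
    obtain ⟨g, hg, hg'⟩ := ha l
    exact ⟨g⁻¹, by simp [hg], by simp [hg']⟩

/-- The subgroup of the sequences in `coreLimit G` whose `l`-th term lies in `G l ⧸ C l`. -/
def discriminantSubgroup (G : ℕ → Subgroup Γ) : Subgroup (∀ l, Γ ⧸ (G l).normalCore) :=
  coreLimit G ⊓ Subgroup.pi Set.univ fun l => (G l).map (QuotientGroup.mk' (G l).normalCore)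

/-- The discriminant group of a descending chain `G` of subgroups of `Γ`: the inverse limit of the
groups `G l ⧸ C l`, where `C l` is the core of `G l` in `Γ`. -/
def Discriminant (G : ℕ → Subgroup Γ) : Type u :=
  discriminantSubgroup G

instance (G : ℕ → Subgroup Γ) : Group (Discriminant G) :=
  inferInstanceAs (Group (discriminantSubgroup G))

/-- The inverse limit topology: the subspace topology of the product of the discrete quotients. -/
instance (G : ℕ → Subgroup Γ) : TopologicalSpace (Discriminant G) :=
  TopologicalSpace.induced (fun d : Discriminant G => d.1)
    (@Pi.topologicalSpace ℕ (fun l => Γ ⧸ (G l).normalCore) fun _ => ⊥)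

end Discriminant

/-! ### Principal bundles and the tower of the cores -/

/-- `q : E → B` is a principal `D`-bundle: `D` acts continuously on `E`, preserving the fibres, and
`q` is locally trivial with fibre `D`, by trivializations that turn the action into translation in
the fibre. -/
structure IsPrincipalBundle (D : Type u) {E B : Type u} [Group D] [TopologicalSpace D]
    [TopologicalSpace E] [TopologicalSpace B] [MulAction D E] (q : E → B) : Prop where
  continuousSMul : ContinuousSMul D E
  proj_smul : ∀ (d : D) (z : E), q (d • z) = q z
  exists_trivialization : ∀ b : B, ∃ e : Bundle.Trivialization D q, b ∈ e.baseSet ∧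
    ∀ (d : D) (z : E), q z ∈ e.baseSet → (e (d • z)).2 = d * (e z).2

/-- `Q` is the tower of the coverings of `P.M 0` attached to the cores of the group chain of `P`
at `x`: its `l`-th space, with base point `z l`, lies over `P.M l` by a covering `r l` such that the
composed covering `Q.M l → P.M l → P.M 0` has the core of `P.groupChain x l` as its group, and the
maps `r l` are compatible with the bonding maps and base points of the two towers. -/
structure IsCoreTower {n : ℕ} (P : CoveringTower.{u} n) (x : P.Limit) (Q : CoveringTower.{u} n)
    (z : Q.Limit) (r : ∀ l, C(Q.M l, P.M l)) : Prop where
  isCoveringMap : ∀ l, IsCoveringMap (r l)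
  comm : ∀ l y, r l (Q.p l y) = P.p l (r (l + 1) y)
  base : ∀ l, r l (z.coord l) = x.coord l
  range_eq : ∀ l,
    (FundamentalGroup.mapOfEq ((P.q l).comp (r l)) (x := z.coord l) (y := x.coord 0)
      ((congrArg (P.q l) (base l)).trans (P.q_coord x l))).range = (P.groupChain x l).normalCore

/-!
A weak solenoid fibres over its base manifold `M₀` with the unique path lifting property, although
its fibres are Cantor sets and it is no covering space. This replaces covering space theory: a map
over `M₀` between such fibrations is a covering on every leaf, and paths of homeomorphisms of `M₀`
lift, which makes the total space homogeneous as soon as each fibre lies in one orbit.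

The covering of `M₀` attached to the core `C_ℓ` is the Galois closure of `q_ℓ : M_ℓ → M₀`: the path
component of the inclusion of the fibre in the space of tuples, indexed by a fixed fibre of `q_ℓ`,
of points of `M_ℓ` in a common fibre. Permuting the indices by monodromy is the action of
`π₁ / C_ℓ`, and in the limit `lim π₁ / C_ℓ` acts simply transitively on the fibres over `M₀`, the
discriminant group being the subgroup that preserves the fibres over the solenoid. A continuous open
surjection of profinite spaces has a section; applied to the fibre over a point of `M₀` and
transported along a contraction of a neighbourhood, it gives the local sections that trivialize the
bundle.
-/

open Set Topology TopologicalSpace unitInterval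

/-! ### Fibrations with unique path lifting -/

/-- A Hurewicz fibration with unique path lifting. Covering maps are the basic example; unlike
covering maps, these are closed under composition and inverse limits, so they include the
projections of a weak solenoid. The homotopy lifting property is only required for spaces in the
universe of the total space and the base, which contains all the spaces to be lifted. -/
structure IsUniqueFibration {X B : Type u} [TopologicalSpace X] [TopologicalSpace B]
    (π : X → B) : Prop where
  continuous : Continuous π
  exists_lift : ∀ {A : Type u} [TopologicalSpace A] (H : C(I × A, B)) (f : C(A, X)),
    (∀ a, H (0, a) = π (f a)) → ∃ H' : C(I × A, X), (∀ z, π (H' z) = H z) ∧ ∀ a, H' (0, a) = f a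
  path_unique : ∀ γ γ' : C(I, X), (∀ t, π (γ t) = π (γ' t)) → γ 0 = γ' 0 → γ = γ'

/-- The plaque over `N` through `x` of a map `π`, which is usually a fibration with unique path
lifting, over a contractible set `N`: the path component of `x` in the preimage of `N`. -/
def plaque {X B : Type*} [TopologicalSpace X] (π : X → B) (N : Set B) (x : X) : Set X :=
  pathComponentIn (π ⁻¹' N) x

theorem isTopologicalBasis_contractible_of_chartedSpace (E B : Type*) [NormedAddCommGroup E]
    [NormedSpace ℝ E] [TopologicalSpace B] [ChartedSpace E B] :
    IsTopologicalBasis {N : Set B | IsOpen N ∧ ContractibleSpace N} := by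
  refine isTopologicalBasis_of_isOpen_of_nhds (fun N hN => hN.1) fun b W hb hW => ?_
  set φ := chartAt E b
  have hbφ : b ∈ φ.source := mem_chart_source E b
  obtain ⟨ε, hε, hball⟩ : ∃ ε > 0, Metric.ball (φ b) ε ⊆ φ.target ∩ φ.symm ⁻¹' W :=
    Metric.isOpen_iff.1 (φ.isOpen_inter_preimage_symm hW) _
      ⟨φ.map_source hbφ, by rwa [mem_preimage, φ.left_inv hbφ]⟩
  have htarget : Metric.ball (φ b) ε ⊆ φ.symm.source := fun v hv => (hball hv).1
  have := Metric.contractibleSpace_ball (x := φ b) hε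
  refine ⟨φ.symm '' Metric.ball (φ b) ε,
    ⟨φ.symm.isOpen_image_of_subset_source Metric.isOpen_ball htarget, ?_⟩,
    ⟨φ b, Metric.mem_ball_self hε, φ.left_inv hbφ⟩, image_subset_iff.2 fun v hv => (hball hv).2⟩
  exact (φ.symm.homeomorphOfImageSubsetSource htarget rfl).symm.contractibleSpace

section Plaque

variable {X B : Type*} [TopologicalSpace X] {π : X → B} {N : Set B} {x y : X}

theorem plaque_subset_preimage : plaque π N x ⊆ π ⁻¹' N :=
  pathComponentIn_subset

theorem mem_plaque_self (hx : π x ∈ N) : x ∈ plaque π N x :=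
  mem_pathComponentIn_self hx

theorem map_mem_of_mem_plaque (hy : y ∈ plaque π N x) : π y ∈ N :=
  pathComponentIn_subset (F := π ⁻¹' N) hy

theorem isPathConnected_plaque (hx : π x ∈ N) : IsPathConnected (plaque π N x) :=
  isPathConnected_pathComponentIn hx

theorem plaque_eq_of_mem (hy : y ∈ plaque π N x) : plaque π N y = plaque π N x :=
  pathComponentIn_congr hy

theorem mem_plaque_comm : y ∈ plaque π N x ↔ x ∈ plaque π N y :=
  ⟨fun h => JoinedIn.symm h, fun h => JoinedIn.symm h⟩

theorem plaque_mono {M : Set B} (h : M ⊆ N) : plaque π M x ⊆ plaque π N x :=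
  pathComponentIn_mono (preimage_mono h)

theorem plaque_subset_pathComponent : plaque π N x ⊆ pathComponent x :=
  fun _ hy => hy.joined

theorem mapsTo_plaque {Y : Type*} [TopologicalSpace Y] {πY : Y → B} (q : C(X, Y))
    (hq : ∀ x, πY (q x) = π x) (x : X) : MapsTo q (plaque π N x) (plaque πY N (q x)) := by
  rintro y ⟨γ, hγ⟩
  exact ⟨γ.map q.continuous, fun t => by simpa [hq] using hγ t⟩

end Plaque

namespace IsUniqueFibration

variable {X Y B : Type u} [TopologicalSpace X] [TopologicalSpace Y] [TopologicalSpace B]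
  {π : X → B} {πY : Y → B} {N : Set B} {x : X}

theorem path_unique_of_eq_one (h : IsUniqueFibration π) {γ γ' : C(I, X)}
    (hγ : ∀ t, π (γ t) = π (γ' t)) (h1 : γ 1 = γ' 1) : γ = γ' := by
  let s : C(I, I) := ⟨σ, unitInterval.continuous_symm⟩
  have := h.path_unique (γ.comp s) (γ'.comp s) (fun t => hγ _) (by simpa [s] using h1)
  ext t
  simpa [s] using DFunLike.congr_fun this (σ t)

theorem exists_path_lift (h : IsUniqueFibration π) (γ : C(I, B)) (x : X) (hx : γ 0 = π x) :
    ∃ γ' : C(I, X), (∀ t, π (γ' t) = γ t) ∧ γ' 0 = x := by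
  obtain ⟨H, hH, hH0⟩ := h.exists_lift (A := PUnit.{u + 1})
    (γ.comp ⟨Prod.fst, continuous_fst⟩) (.const _ x) (fun _ => hx)
  exact ⟨H.comp ⟨fun t => (t, PUnit.unit), by fun_prop⟩, fun t => hH _, hH0 _⟩

theorem exists_continuous_section (h : IsUniqueFibration π) [ContractibleSpace N]
    (hx : π x ∈ N) : ∃ S : C(N, X), (∀ v, π (S v) = v) ∧ S ⟨π x, hx⟩ = x := by
  obtain ⟨c, ⟨K⟩⟩ := id_nullhomotopic N
  let ι : C(N, B) := ⟨Subtype.val, continuous_subtype_val⟩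
  -- Contract `π x` to `c`, lift this path from `x`, and lift the reversed contraction from its end.
  obtain ⟨β, hβ, hβ0⟩ := h.exists_path_lift ⟨fun t => K (t, ⟨π x, hx⟩), by fun_prop⟩ x (by simp)
  have hβ1 : π (β 1) = c := by simpa using hβ 1
  obtain ⟨H, hH, hH0⟩ := h.exists_lift (ι.comp K.symm.toContinuousMap) (.const _ (β 1))
    fun a => by simp [ι, hβ1]
  refine ⟨H.comp ⟨fun v => (1, v), by fun_prop⟩, fun v => by simp [hH, ι], ?_⟩
  have := h.path_unique_of_eq_one (γ := β)
    (γ' := H.comp ⟨fun t => (σ t, ⟨π x, hx⟩), by fun_prop⟩)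
    (fun t => by simp [hH, hβ, ι]) (by simp [hH0])
  simpa [hβ0] using (DFunLike.congr_fun this 0).symm

theorem range_section_eq_plaque (h : IsUniqueFibration π) [PathConnectedSpace N] {S : C(N, X)}
    (hS : ∀ v, π (S v) = v) (v : N) : range S = plaque π N (S v) := by
  apply Subset.antisymm
  · exact (isPathConnected_range S.continuous).subset_pathComponentIn (mem_range_self v)
      (range_subset_iff.2 fun w => by simp [hS])
  · rintro z ⟨γ, hγ⟩
    have := h.path_unique (S.comp ⟨fun t => ⟨π (γ t), hγ t⟩,
      (h.continuous.comp γ.continuous).subtype_mk _⟩) γ.toContinuousMap (fun t => hS _)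
      (by simp [hS])
    exact ⟨⟨π z, by simpa using hγ 1⟩, by simpa using DFunLike.congr_fun this 1⟩

theorem bijOn_plaque (h : IsUniqueFibration π) [ContractibleSpace N] (hx : π x ∈ N) :
    BijOn π (plaque π N x) N := by
  obtain ⟨S, hS, hSx⟩ := h.exists_continuous_section hx
  have hrange := h.range_section_eq_plaque hS ⟨π x, hx⟩
  rw [hSx] at hrange
  refine ⟨plaque_subset_preimage, ?_, fun v hv => ⟨S ⟨v, hv⟩, ?_, hS _⟩⟩
  · rw [← hrange]
    rintro _ ⟨v, rfl⟩ _ ⟨w, rfl⟩ hvw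
    rw [hS, hS] at hvw
    rw [Subtype.ext hvw]
  · exact hrange ▸ mem_range_self _

theorem exists_plaque_subset (h : IsUniqueFibration π) (hN : IsOpen N) [ContractibleSpace N]
    (hx : π x ∈ N) {O : Set X} (hO : IsOpen O) (hxO : x ∈ O) :
    ∃ M ∈ 𝓝 (π x), plaque π M x ⊆ O := by
  obtain ⟨S, hS, hSx⟩ := h.exists_continuous_section hx
  have hrange := h.range_section_eq_plaque hS ⟨π x, hx⟩
  rw [hSx] at hrange
  refine ⟨Subtype.val '' (S ⁻¹' O), (hN.isOpenMap_subtype_val _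
    (hO.preimage S.continuous)).mem_nhds ⟨⟨π x, hx⟩, by simpa [hSx] using hxO, rfl⟩, ?_⟩
  intro z hz
  obtain ⟨v, rfl⟩ := hrange.symm ▸ plaque_mono (Subtype.coe_image_subset N _) hz
  obtain ⟨w, hw, hwv⟩ := map_mem_of_mem_plaque hz
  rw [hS] at hwv
  rwa [← Subtype.ext hwv]

end IsUniqueFibration

/-! ### Leaves of the total space of a fibration -/

theorem isOpen_leafTopology_pathComponentIn {X : Type u} [TopologicalSpace X] {U : Set X}
    (hU : IsOpen U) (x : X) : IsOpen[leafTopology X] (pathComponentIn U x) := by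
  by_cases hx : x ∈ U
  · exact .basic _ ⟨U, hU, x, hx, rfl⟩
  · rw [not_nonempty_iff_eq_empty.1 (mt pathComponentIn_nonempty_iff.1 hx)]
    exact @isOpen_empty _ (leafTopology X)

section LeafTopology

variable {X B : Type u} [TopologicalSpace X] [TopologicalSpace B] {π : X → B}

theorem IsUniqueFibration.exists_plaque_subset_of_isOpen_leafTopology (h : IsUniqueFibration π)
    (hB : IsTopologicalBasis {N : Set B | IsOpen N ∧ ContractibleSpace N})
    {Z : Set X} (hZ : IsOpen[leafTopology X] Z) {x : X} (hx : x ∈ Z) :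
    ∃ N ∈ 𝓝 (π x), plaque π N x ⊆ Z := by
  induction hZ generalizing x with
  | basic s hs =>
    obtain ⟨O, hO, y, -, rfl⟩ := hs
    obtain ⟨N, ⟨hN, _⟩, hxN, -⟩ := hB.exists_subset_of_mem_open (mem_univ (π x)) isOpen_univ
    obtain ⟨M, hM, hMO⟩ := h.exists_plaque_subset hN hxN hO (pathComponentIn_subset hx)
    refine ⟨M, hM, ?_⟩
    rw [← pathComponentIn_congr hx]
    have hxM : π x ∈ M := mem_of_mem_nhds hM
    exact (isPathConnected_plaque hxM).subset_pathComponentIn (mem_plaque_self hxM) hMO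
  | univ => exact ⟨univ, Filter.univ_mem, subset_univ _⟩
  | inter s t _ _ ihs iht =>
    obtain ⟨M, hM, hMs⟩ := ihs hx.1
    obtain ⟨N, hN, hNt⟩ := iht hx.2
    exact ⟨M ∩ N, Filter.inter_mem hM hN, subset_inter
      ((plaque_mono inter_subset_left).trans hMs) ((plaque_mono inter_subset_right).trans hNt)⟩
  | sUnion S _ ih =>
    obtain ⟨s, hs, hxs⟩ := hx
    obtain ⟨N, hN, hNs⟩ := ih s hs hxs
    exact ⟨N, hN, hNs.trans (subset_sUnion_of_mem hs)⟩

theorem IsUniqueFibration.isOpen_image_of_isOpen_leafTopology (h : IsUniqueFibration π)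
    (hB : IsTopologicalBasis {N : Set B | IsOpen N ∧ ContractibleSpace N}) {Z : Set X}
    (hZ : IsOpen[leafTopology X] Z) : IsOpen (π '' Z) := by
  rw [isOpen_iff_mem_nhds]
  rintro _ ⟨z, hz, rfl⟩
  obtain ⟨M, hM, hMZ⟩ := h.exists_plaque_subset_of_isOpen_leafTopology hB hZ hz
  obtain ⟨N, ⟨hN, _⟩, hzN, hNM⟩ := hB.mem_nhds_iff.1 hM
  refine Filter.mem_of_superset (hN.mem_nhds hzN) ?_
  rw [← (h.bijOn_plaque hzN).image_eq]
  exact image_mono ((plaque_mono hNM).trans hMZ)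

theorem IsUniqueFibration.isOpen_leafTopology_of_isOpen_image (h : IsUniqueFibration π)
    {N : Set B} [ContractibleSpace N] {x : X} (hx : π x ∈ N) {Z : Set X} (hZ : Z ⊆ plaque π N x)
    (ho : IsOpen (π '' Z)) : IsOpen[leafTopology X] Z := by
  have hZN : π '' Z ⊆ N := image_subset_iff.2 (hZ.trans plaque_subset_preimage)
  have hunion : Z = ⋃ z ∈ Z, plaque π (π '' Z) z := by
    refine Subset.antisymm (fun y hy => mem_biUnion hy (mem_plaque_self ⟨y, hy, rfl⟩))
      (iUnion₂_subset fun z hz y hy => ?_)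
    obtain ⟨y', hy', hyy'⟩ := map_mem_of_mem_plaque hy
    have hyN : y ∈ plaque π N x := plaque_eq_of_mem (hZ hz) ▸ plaque_mono hZN hy
    rwa [← (h.bijOn_plaque hx).injOn (hZ hy') hyN hyy']
  rw [hunion]
  exact @isOpen_biUnion _ _ (leafTopology X) _ _ fun z _ =>
    isOpen_leafTopology_pathComponentIn (ho.preimage h.continuous) z

end LeafTopology

theorem isOpen_leaf_iff {X : Type u} [TopologicalSpace X] {x : X} {Z : Set (Leaf x)} :
    IsOpen Z ↔ IsOpen[leafTopology X] ((fun y : Leaf x => y.1) '' Z) := by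
  have hL : IsOpen[leafTopology X] (pathComponent x) := by
    rw [← pathComponentIn_univ]
    exact isOpen_leafTopology_pathComponentIn isOpen_univ x
  have he : @IsOpenEmbedding (Leaf x) X _ (leafTopology X) (fun y : Leaf x => y.1) :=
    @IsOpen.isOpenEmbedding_subtypeVal X (leafTopology X) _ hL
  exact @IsOpenEmbedding.isOpen_iff_image_isOpen _ _ _ _ (leafTopology X) he _

/-- The plaque through a point of a leaf, as a subset of this leaf. -/
def leafPlaque {X B : Type u} [TopologicalSpace X] (π : X → B) (N : Set B) {x : X} (y : Leaf x) :
    Set (Leaf x) :=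
  {v | v.1 ∈ plaque π N y.1}

section LeafPlaque

variable {X B : Type u} [TopologicalSpace X] {π : X → B} {N : Set B} {x : X} {y : Leaf x}

theorem val_image_leafPlaque : (fun v : Leaf x => v.1) '' leafPlaque π N y = plaque π N y.1 :=
  (image_subset_iff.2 fun _ hv => hv).antisymm fun v hv =>
    ⟨⟨v, y.2.trans (plaque_subset_pathComponent hv)⟩, hv, rfl⟩

variable [TopologicalSpace B]

theorem isOpen_leafPlaque (hπ : Continuous π) (hN : IsOpen N) : IsOpen (leafPlaque π N y) := by
  rw [isOpen_leaf_iff, val_image_leafPlaque]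
  exact isOpen_leafTopology_pathComponentIn (hN.preimage hπ) _

namespace IsUniqueFibration

theorem bijOn_leafPlaque (h : IsUniqueFibration π) [ContractibleSpace N] (hy : π y.1 ∈ N) :
    BijOn (fun v : Leaf x => π v.1) (leafPlaque π N y) N := by
  have hval : BijOn (fun v : Leaf x => v.1) (leafPlaque π N y) (plaque π N y.1) :=
    val_image_leafPlaque (π := π) ▸
      (Function.Injective.injOn fun _ _ => Subtype.ext).bijOn_image
  exact (h.bijOn_plaque hy).comp hval

theorem isOpen_iff_isOpen_image (h : IsUniqueFibration π)
    (hB : IsTopologicalBasis {N : Set B | IsOpen N ∧ ContractibleSpace N})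
    [ContractibleSpace N] (hy : π y.1 ∈ N) {Z : Set (Leaf x)} (hZ : Z ⊆ leafPlaque π N y) :
    IsOpen Z ↔ IsOpen ((fun v : Leaf x => π v.1) '' Z) := by
  rw [isOpen_leaf_iff, ← image_image π]
  exact ⟨h.isOpen_image_of_isOpen_leafTopology hB,
    h.isOpen_leafTopology_of_isOpen_image hy (image_subset_iff.2 hZ)⟩

end IsUniqueFibration

end LeafPlaque

section LeafMap

variable {X Y B : Type u} [TopologicalSpace X] [TopologicalSpace Y] {π : X → B} {πY : Y → B}
  {q : C(X, Y)} {N : Set B} {x : X}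

theorem mapsTo_leafPlaque (hq : ∀ x, πY (q x) = π x) (y : Leaf x) :
    MapsTo (leafMap q x) (leafPlaque π N y) (leafPlaque πY N (leafMap q x y)) :=
  fun _ hv => mapsTo_plaque q hq _ hv

variable [TopologicalSpace B]

namespace IsUniqueFibration

theorem surjective_leafMap (h : IsUniqueFibration π) (hY : IsUniqueFibration πY)
    (hq : ∀ x, πY (q x) = π x) (x : X) : Function.Surjective (leafMap q x) := by
  rintro ⟨y, ⟨γ⟩⟩
  obtain ⟨γ', hγ', h0⟩ := h.exists_path_lift ((⟨πY, hY.continuous⟩ : C(Y, B)).comp γ) x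
    (by simp [hq])
  have := hY.path_unique (q.comp γ') γ.toContinuousMap (fun t => by simp [hq, hγ']) (by simp [h0])
  refine ⟨⟨γ' 1, ⟨⟨γ', h0, rfl⟩⟩⟩, Subtype.ext ?_⟩
  simpa [leafMap] using DFunLike.congr_fun this 1

theorem bijOn_leafMap_leafPlaque (h : IsUniqueFibration π) (hY : IsUniqueFibration πY)
    (hq : ∀ x, πY (q x) = π x) [ContractibleSpace N] {y : Leaf x} (hy : π y.1 ∈ N) :
    BijOn (leafMap q x) (leafPlaque π N y) (leafPlaque πY N (leafMap q x y)) := by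
  have hπY : BijOn (fun w : Leaf (q x) => πY w.1) (leafPlaque πY N (leafMap q x y)) N :=
    hY.bijOn_leafPlaque ((hq y.1).symm ▸ hy)
  have hcomp : BijOn ((fun w : Leaf (q x) => πY w.1) ∘ leafMap q x) (leafPlaque π N y) N :=
    (h.bijOn_leafPlaque hy).congr fun v _ => (hq v.1).symm
  refine ⟨mapsTo_leafPlaque hq y, InjOn.of_comp hcomp.injOn, fun w hw => ?_⟩
  obtain ⟨v, hv, hvw⟩ := hcomp.surjOn (hπY.mapsTo hw)
  exact ⟨v, hv, hπY.injOn (mapsTo_leafPlaque hq y hv) hw hvw⟩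

theorem preimage_leafPlaque_subset (h : IsUniqueFibration π) (hY : IsUniqueFibration πY)
    (hq : ∀ x, πY (q x) = π x) [ContractibleSpace N] {y : Leaf (q x)} :
    leafMap q x ⁻¹' leafPlaque πY N y ⊆ ⋃ i : leafMap q x ⁻¹' {y}, leafPlaque π N i.1 := by
  intro v hv
  have hvN : π v.1 ∈ N := hq v.1 ▸ map_mem_of_mem_plaque hv
  obtain ⟨w, hw, hwy⟩ := (h.bijOn_leafMap_leafPlaque hY hq hvN).surjOn
    (show y ∈ leafPlaque πY N (leafMap q x v) from mem_plaque_comm.1 hv)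
  exact mem_iUnion.2 ⟨⟨w, hwy⟩, mem_plaque_comm.1 hw⟩

theorem pairwise_disjoint_leafPlaque (h : IsUniqueFibration π) (hq : ∀ x, πY (q x) = π x)
    [ContractibleSpace N] {y : Leaf (q x)} (hy : πY y.1 ∈ N) :
    Pairwise (Function.onFun Disjoint
      fun i : leafMap q x ⁻¹' {y} => leafPlaque π N i.1) := by
  have hπ : ∀ i : leafMap q x ⁻¹' {y}, π i.1.1 = πY y.1 := fun i => by
    rw [← hq]
    exact congrArg (fun w : Leaf (q x) => πY w.1) i.2
  intro i j hij
  refine Set.disjoint_left.2 fun v hvi hvj => hij (Subtype.ext ?_)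
  have hiN : π i.1.1 ∈ N := (hπ i).symm ▸ hy
  have hj : j.1 ∈ leafPlaque π N i.1 := by
    change j.1.1 ∈ plaque π N i.1.1
    rw [← plaque_eq_of_mem hvi]
    exact mem_plaque_comm.1 hvj
  exact (h.bijOn_leafPlaque hiN).injOn (mem_plaque_self hiN) hj ((hπ i).trans (hπ j).symm)

theorem isOpen_iff_isOpen_preimage_leafMap (h : IsUniqueFibration π) (hY : IsUniqueFibration πY)
    (hB : IsTopologicalBasis {N : Set B | IsOpen N ∧ ContractibleSpace N})
    (hq : ∀ x, πY (q x) = π x) [ContractibleSpace N] {y : Leaf x} (hy : π y.1 ∈ N)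
    {W : Set (Leaf (q x))} (hW : W ⊆ leafPlaque πY N (leafMap q x y)) :
    IsOpen W ↔ IsOpen (leafMap q x ⁻¹' W ∩ leafPlaque π N y) := by
  have himage : leafMap q x '' (leafMap q x ⁻¹' W ∩ leafPlaque π N y) = W := by
    rw [image_preimage_inter, (h.bijOn_leafMap_leafPlaque hY hq hy).image_eq,
      inter_eq_left.2 hW]
  have hqy : πY (leafMap q x y).1 ∈ N := (hq y.1).symm ▸ hy
  rw [hY.isOpen_iff_isOpen_image hB hqy hW, h.isOpen_iff_isOpen_image hB hy inter_subset_right]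
  nth_rw 1 [← himage]
  simp only [image_image, leafMap, hq]

theorem isCoveringMap_leafMap (h : IsUniqueFibration π) (hY : IsUniqueFibration πY)
    (hB : IsTopologicalBasis {N : Set B | IsOpen N ∧ ContractibleSpace N})
    (hq : ∀ x, πY (q x) = π x) (x : X) : IsCoveringMap (leafMap q x) := by
  intro y
  obtain ⟨N, ⟨hN, _⟩, hyN, -⟩ := hB.exists_subset_of_mem_open (mem_univ (πY y.1)) isOpen_univ
  have hfibre : ∀ i : leafMap q x ⁻¹' {y}, leafMap q x i.1 = y := fun i => i.2
  have hiN : ∀ i : leafMap q x ⁻¹' {y}, π i.1.1 ∈ N := fun i => by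
    rw [← hq]
    exact congrArg (fun w : Leaf (q x) => πY w.1) (hfibre i) ▸ hyN
  have hbij : ∀ i : leafMap q x ⁻¹' {y},
      BijOn (leafMap q x) (leafPlaque π N i.1) (leafPlaque πY N y) := fun i => by
    simpa only [hfibre i] using h.bijOn_leafMap_leafPlaque hY hq (hiN i)
  let _ : TopologicalSpace (leafMap q x ⁻¹' {y}) := ⊥
  have : DiscreteTopology (leafMap q x ⁻¹' {y}) := ⟨rfl⟩
  have : Nonempty (leafMap q x ⁻¹' {y}) := nonempty_subtype.2 (h.surjective_leafMap hY hq x y)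
  have : Nonempty (Leaf (q x) → Leaf x) := ⟨fun _ => ⟨x, mem_pathComponent_self x⟩⟩
  let t := (isOpen_leafPlaque (y := y) hY.continuous hN).trivializationDiscrete
    (fun i : leafMap q x ⁻¹' {y} => leafPlaque π N i.1) _
    (fun i {W} hW => h.isOpen_iff_isOpen_preimage_leafMap hY hB hq (hiN i)
      (by rwa [hfibre i]))
    (fun i => (hbij i).injOn) (fun i => (hbij i).surjOn)
    (h.pairwise_disjoint_leafPlaque hq hyN) (h.preimage_leafPlaque_subset hY hq)
  exact (IsEvenlyCovered.of_trivialization (t := t)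
    (mem_plaque_self hyN)).to_isEvenlyCovered_preimage

end IsUniqueFibration

end LeafMap

/-! ### Homogeneity -/

section ConeBump

variable {E : Type*} [NormedAddCommGroup E]

/-- The conical bump function at `c` of radius `r`, used to push points of a chart around without
moving anything outside of a ball. A cone is enough because only continuity is needed. -/
noncomputable def coneBump (c : E) (r : ℝ) (x : E) : ℝ :=
  max 0 (1 - ‖x - c‖ / r)

variable {c : E} {r : ℝ}

theorem continuous_coneBump (c : E) (r : ℝ) : Continuous (coneBump c r) := by
  unfold coneBump
  fun_prop

@[simp]
theorem coneBump_self (c : E) (r : ℝ) : coneBump c r c = 1 := by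
  simp [coneBump]

theorem coneBump_nonneg (c : E) (r : ℝ) (x : E) : 0 ≤ coneBump c r x :=
  le_max_left _ _

theorem coneBump_eq_zero (hr : 0 < r) {x : E} (hx : r ≤ ‖x - c‖) : coneBump c r x = 0 :=
  max_eq_left (by rw [sub_nonpos, one_le_div hr]; exact hx)

theorem coneBump_mul_radius (hr : 0 < r) {x : E} (hx : ‖x - c‖ ≤ r) :
    coneBump c r x * r = r - ‖x - c‖ := by
  rw [coneBump, max_eq_right (by rw [sub_nonneg, div_le_one hr]; exact hx)]
  field_simp

theorem abs_coneBump_sub_le (c : E) (hr : 0 < r) (x y : E) :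
    |coneBump c r x - coneBump c r y| ≤ ‖x - y‖ / r := by
  refine (abs_max_sub_max_le_max _ _ _ _).trans (max_le ?_ ?_)
  · rw [sub_self, abs_zero]
    positivity
  calc |1 - ‖x - c‖ / r - (1 - ‖y - c‖ / r)| = |‖y - c‖ - ‖x - c‖| / r := by
        rw [sub_sub_sub_cancel_left, ← sub_div, abs_div, abs_of_pos hr]
    _ ≤ ‖x - y‖ / r := by
        rw [norm_sub_rev x y]
        gcongr
        simpa using abs_norm_sub_norm_le (y - c) (x - c)

theorem bijective_add_of_lipschitzWith [CompleteSpace E] {K : NNReal} (hK : K < 1) {f : E → E}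
    (hf : LipschitzWith K f) : Function.Bijective fun x => x + f x := by
  have hcontr (y : E) : ContractingWith K fun x => y - f x :=
    ⟨hK, LipschitzWith.of_dist_le_mul fun a b => by
      simpa only [dist_sub_left] using hf.dist_le_mul a b⟩
  have hfix (x y : E) : x + f x = y ↔ Function.IsFixedPt (fun x => y - f x) x := by
    rw [Function.IsFixedPt, sub_eq_iff_eq_add, eq_comm]
  refine ⟨fun x x' hxx' => ?_, fun y => ⟨(hcontr y).fixedPoint _, ?_⟩⟩
  · exact (hcontr _).fixedPoint_unique' ((hfix x _).1 hxx') ((hfix x' _).1 rfl)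
  · exact (hfix _ y).2 (hcontr y).fixedPoint_isFixedPt

variable [NormedSpace ℝ E]

theorem lipschitzWith_coneBump_smul (c v : E) (hr : 0 < r) :
    LipschitzWith (Real.toNNReal (‖v‖ / r)) fun x => coneBump c r x • v := by
  refine LipschitzWith.of_dist_le' fun x y => ?_
  rw [dist_eq_norm, ← sub_smul, norm_smul, Real.norm_eq_abs, dist_eq_norm]
  calc |coneBump c r x - coneBump c r y| * ‖v‖ ≤ ‖x - y‖ / r * ‖v‖ := by
        gcongr
        exact abs_coneBump_sub_le c hr x y
    _ = ‖v‖ / r * ‖x - y‖ := by ring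

theorem bijective_add_coneBump_smul [CompleteSpace E] (c : E) {v : E} (hv : ‖v‖ < r) :
    Function.Bijective fun x => x + coneBump c r x • v := by
  have hr : 0 < r := (norm_nonneg v).trans_lt hv
  refine bijective_add_of_lipschitzWith ?_ (lipschitzWith_coneBump_smul c v hr)
  rwa [Real.toNNReal_lt_one, div_lt_one hr]

theorem norm_add_smul_coneBump_smul_sub_le {v : E} (hv : ‖v‖ < r) {x : E} (hx : ‖x - c‖ ≤ r)
    (t : I) : ‖x + (t : ℝ) • coneBump c r x • v - c‖ ≤ r := by
  have hr : 0 < r := (norm_nonneg v).trans_lt hv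
  have hnonneg := coneBump_nonneg c r x
  calc ‖x + (t : ℝ) • coneBump c r x • v - c‖ ≤ ‖x - c‖ + t * (coneBump c r x * ‖v‖) := by
        rw [add_sub_right_comm]
        refine (norm_add_le _ _).trans_eq ?_
        rw [norm_smul, norm_smul, Real.norm_of_nonneg t.2.1, Real.norm_of_nonneg hnonneg]
    _ ≤ ‖x - c‖ + 1 * (coneBump c r x * r) := by gcongr; exact t.2.2
    _ = r := by rw [coneBump_mul_radius hr hx]; ring

end ConeBump

section ChartExtension

variable {A E B : Type*} [TopologicalSpace E] [TopologicalSpace B]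

open Classical in
/-- The self-map of `B` that is `g` in the chart `φ` and the identity off the domain of `φ`; it is
meaningful if `g` preserves the target of `φ`. -/
noncomputable def chartExtension (φ : OpenPartialHomeomorph B E) (g : E → E) (b : B) : B :=
  if b ∈ φ.source then φ.symm (g (φ b)) else b

variable {φ : OpenPartialHomeomorph B E} {g g' : E → E} {b : B}

theorem chartExtension_of_mem (g : E → E) (hb : b ∈ φ.source) :
    chartExtension φ g b = φ.symm (g (φ b)) :=
  if_pos hb

theorem chartExtension_of_notMem (g : E → E) (hb : b ∉ φ.source) : chartExtension φ g b = b :=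
  if_neg hb

theorem chartExtension_eq_self (hg : b ∈ φ.source → g (φ b) = φ b) : chartExtension φ g b = b := by
  by_cases hb : b ∈ φ.source
  · rw [chartExtension_of_mem g hb, hg hb, φ.left_inv hb]
  · exact chartExtension_of_notMem g hb

theorem chartExtension_chartExtension (hg : MapsTo g φ.target φ.target) :
    chartExtension φ g' (chartExtension φ g b) = chartExtension φ (g' ∘ g) b := by
  by_cases hb : b ∈ φ.source
  · have hgb := hg (φ.map_source hb)
    rw [chartExtension_of_mem g hb, chartExtension_of_mem g' (φ.map_target hgb),
      chartExtension_of_mem _ hb, φ.right_inv hgb, Function.comp_apply]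
  · simp only [chartExtension_of_notMem _ hb]

theorem mapsTo_of_injective_of_eq_self {α : Type*} {g : α → α} {s : Set α}
    (hg : Function.Injective g) (hid : ∀ x ∉ s, g x = x) : MapsTo g s s := by
  intro x hx
  by_contra hgx
  exact hgx (by rwa [hg (hid _ hgx)])

theorem bijective_chartExtension (hg : Function.Bijective g) (hid : ∀ x ∉ φ.target, g x = x) :
    Function.Bijective (chartExtension φ g) := by
  obtain ⟨e, rfl⟩ : ∃ e : E ≃ E, g = e := ⟨.ofBijective g hg, rfl⟩
  have hid' : ∀ x ∉ φ.target, e.symm x = x := fun x hx => by rw [e.symm_apply_eq, hid x hx]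
  refine Function.bijective_iff_has_inverse.2 ⟨chartExtension φ e.symm, fun b => ?_, fun b => ?_⟩
  · rw [chartExtension_chartExtension (mapsTo_of_injective_of_eq_self e.injective hid)]
    exact chartExtension_eq_self fun _ => by simp
  · rw [chartExtension_chartExtension (mapsTo_of_injective_of_eq_self e.symm.injective hid')]
    exact chartExtension_eq_self fun _ => by simp

theorem continuous_chartExtension [TopologicalSpace A] [T2Space B] {g : A → E → E}
    (hg : Continuous fun z : A × E => g z.1 z.2) (hmaps : ∀ a, MapsTo (g a) φ.target φ.target)
    {K : Set E} (hK : IsCompact K) (hKφ : K ⊆ φ.target) (hid : ∀ a, ∀ x ∉ K, g a x = x) :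
    Continuous fun z : A × B => chartExtension φ (g z.1) z.2 := by
  have hclosed : IsClosed (φ.symm '' K) :=
    (hK.image_of_continuousOn (φ.continuousOn_symm.mono hKφ)).isClosed
  have hsource : ContinuousOn (fun z : A × B => chartExtension φ (g z.1) z.2)
      (Prod.snd ⁻¹' φ.source) := by
    refine ContinuousOn.congr (f := fun z => φ.symm (g z.1 (φ z.2))) ?_
      fun z hz => chartExtension_of_mem _ hz
    refine φ.continuousOn_symm.comp ?_ fun z hz => hmaps _ (φ.map_source hz)
    exact hg.comp_continuousOn (continuous_fst.continuousOn.prodMk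
      (φ.continuousOn.comp continuous_snd.continuousOn fun _ hz => hz))
  rw [continuous_iff_continuousAt]
  rintro ⟨a, b⟩
  by_cases hb : b ∈ φ.symm '' K
  · obtain ⟨x, hx, rfl⟩ := hb
    exact hsource.continuousAt
      ((φ.open_source.preimage continuous_snd).mem_nhds (φ.map_target (hKφ hx)))
  · refine continuous_snd.continuousAt.congr ?_
    filter_upwards [(hclosed.isOpen_compl.preimage continuous_snd).mem_nhds hb] with z hz
    exact (chartExtension_eq_self fun hzs => hid _ _ fun hzK =>
      hz ⟨φ z.2, hzK, φ.left_inv hzs⟩).symm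

end ChartExtension

theorem exists_homotopy_moving_of_chartedSpace (E : Type*) {B : Type*} [NormedAddCommGroup E]
    [NormedSpace ℝ E] [ProperSpace E] [TopologicalSpace B] [T2Space B] [ChartedSpace E B] (b : B) :
    ∃ N ∈ 𝓝 b, ∀ b' ∈ N, ∃ H : C(I × B, B), (∀ a, H (0, a) = a) ∧
      Function.Bijective (fun a => H (1, a)) ∧ H (1, b) = b' := by
  set φ := chartAt E b
  have hb : b ∈ φ.source := mem_chart_source E b
  obtain ⟨r, hr, hrφ⟩ : ∃ r > 0, Metric.closedBall (φ b) r ⊆ φ.target :=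
    Metric.nhds_basis_closedBall.mem_iff.1 (φ.open_target.mem_nhds (φ.map_source hb))
  refine ⟨φ.source ∩ φ ⁻¹' Metric.ball (φ b) r,
    (φ.isOpen_inter_preimage Metric.isOpen_ball).mem_nhds ⟨hb, Metric.mem_ball_self hr⟩,
    fun b' ⟨hb', hb'r⟩ => ?_⟩
  set v := φ b' - φ b with hv_def
  have hv : ‖v‖ < r := mem_ball_iff_norm.1 hb'r
  let g (t : I) (x : E) : E := x + (t : ℝ) • coneBump (φ b) r x • v
  have hid : ∀ t, ∀ x ∉ Metric.closedBall (φ b) r, g t x = x := fun t x hx => by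
    rw [mem_closedBall_iff_norm, not_le] at hx
    simp [g, coneBump_eq_zero hr hx.le]
  have hmaps (t : I) : MapsTo (g t) φ.target φ.target := fun x hx => by
    by_cases hxr : x ∈ Metric.closedBall (φ b) r
    · refine hrφ (mem_closedBall_iff_norm.2 ?_)
      exact norm_add_smul_coneBump_smul_sub_le hv (mem_closedBall_iff_norm.1 hxr) t
    · rwa [hid t x hxr]
  have hg : Continuous fun z : I × E => g z.1 z.2 := by
    have := continuous_coneBump (φ b) r
    fun_prop
  have hbij : Function.Bijective (g 1) := by simpa [g] using bijective_add_coneBump_smul (φ b) hv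
  refine ⟨⟨fun z => chartExtension φ (g z.1) z.2,
    continuous_chartExtension hg hmaps (isCompact_closedBall _ r) hrφ hid⟩,
    fun a => chartExtension_eq_self fun _ => by simp [g],
    bijective_chartExtension hbij fun x hx => hid 1 x (notMem_subset hrφ hx), ?_⟩
  change chartExtension φ (g 1) b = b'
  rw [chartExtension_of_mem _ hb]
  simp [g, hv_def, φ.left_inv hb']

namespace IsUniqueFibration

variable {X B : Type u} [TopologicalSpace X] [TopologicalSpace B] {π : X → B}

theorem bijective_of_homotopy_lift (h : IsUniqueFibration π) {H : C(I × B, B)}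
    (H0 : ∀ b, H (0, b) = b) (H1 : Function.Bijective fun b => H (1, b)) {H' : C(I × X, X)}
    (hH : ∀ t x, π (H' (t, x)) = H (t, π x)) (h0 : ∀ x, H' (0, x) = x) :
    Function.Bijective fun x => H' (1, x) := by
  let track (x : X) : C(I, X) := H'.comp ⟨fun t => (t, x), by fun_prop⟩
  refine ⟨fun x y (hxy : H' (1, x) = H' (1, y)) => ?_, fun y => ?_⟩
  · have hπ : π x = π y := H1.1 (by simp only [← hH, hxy])
    have htrack : track x = track y :=
      h.path_unique_of_eq_one (fun t => by simp [track, hH, hπ]) hxy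
    simpa [track, h0] using DFunLike.congr_fun htrack 0
  · -- A preimage of `y` is found by lifting the track that leads to `π y` backwards from `y`.
    obtain ⟨b, hb⟩ := H1.2 (π y)
    obtain ⟨β, hβ, hβ0⟩ := h.exists_path_lift (H.comp ⟨fun t => (σ t, b), by fun_prop⟩) y
      (by simpa using hb)
    have hβ1 : π (β 1) = b := by simp [hβ, H0]
    have htrack : track (β 1) = β.comp ⟨σ, unitInterval.continuous_symm⟩ :=
      h.path_unique _ _ (fun t => by simp [track, hH, hβ1, hβ]) (by simp [track, h0])
    exact ⟨β 1, by simpa [track, hβ0] using DFunLike.congr_fun htrack 1⟩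

theorem exists_homeomorph_lift [CompactSpace X] [T2Space X] (h : IsUniqueFibration π)
    {H : C(I × B, B)} (H0 : ∀ b, H (0, b) = b) (H1 : Function.Bijective fun b => H (1, b)) :
    ∃ f : X ≃ₜ X, ∀ x, π (f x) = H (1, π x) := by
  obtain ⟨H', hH', h0⟩ := h.exists_lift
    (H.comp ((ContinuousMap.id I).prodMap ⟨π, h.continuous⟩)) (.id X) (by simp [H0])
  have hH (t : I) (x : X) : π (H' (t, x)) = H (t, π x) := by simp [hH']
  have hbij := h.bijective_of_homotopy_lift H0 H1 hH (by simpa using h0)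
  have hc : Continuous (Equiv.ofBijective _ hbij) :=
    H'.continuous.comp (Continuous.prodMk_right 1)
  exact ⟨hc.homeoOfEquivCompactToT2, hH 1⟩

theorem isHomogeneousSpace [CompactSpace X] [T2Space X] [PreconnectedSpace X]
    (h : IsUniqueFibration π)
    (hB : ∀ b : B, ∃ N ∈ 𝓝 b, ∀ b' ∈ N, ∃ H : C(I × B, B), (∀ a, H (0, a) = a) ∧
      Function.Bijective (fun a => H (1, a)) ∧ H (1, b) = b')
    (hfib : ∀ x y, π x = π y → ∃ f : X ≃ₜ X, f x = y) : IsHomogeneousSpace X := by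
  have hnhds (x : X) : ∀ᶠ y in 𝓝 x, ∃ f : X ≃ₜ X, f x = y := by
    obtain ⟨N, hN, hmove⟩ := hB (π x)
    filter_upwards [h.continuous.continuousAt.preimage_mem_nhds hN] with y hy
    obtain ⟨H, H0, H1, hH⟩ := hmove _ hy
    obtain ⟨k, hk⟩ := h.exists_homeomorph_lift H0 H1
    obtain ⟨d, hd⟩ := hfib (k x) y (by rw [hk, hH])
    exact ⟨k.trans d, hd⟩
  have hsymm : Std.Symm fun x y : X => ∃ f : X ≃ₜ X, f x = y :=
    ⟨fun _ _ ⟨f, hf⟩ => ⟨f.symm, by rw [← hf, f.symm_apply_apply]⟩⟩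
  exact PreconnectedSpace.induction₂ _ hnhds
    ⟨fun _ _ _ ⟨f, hf⟩ ⟨k, hk⟩ => ⟨f.trans k, by rw [← hk, ← hf, f.trans_apply]⟩⟩

end IsUniqueFibration

/-! ### Continuous sections -/

section ContinuousSection

variable {F G : Type*} {q : F → G}

/-- The part of `K` obtained by discarding the complement of `U` in every fibre of `q : K → q(K)`
that meets `U`. -/
def fibreTrim (q : F → G) (K U : Set F) : Set F :=
  K ∩ (U ∪ (q ⁻¹' (q '' (K ∩ U)))ᶜ)

theorem fibreTrim_subset (q : F → G) (K U : Set F) : fibreTrim q K U ⊆ K :=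
  inter_subset_left

theorem image_fibreTrim (q : F → G) (K U : Set F) : q '' fibreTrim q K U = q '' K := by
  refine Subset.antisymm (image_mono (fibreTrim_subset q K U)) ?_
  rintro _ ⟨x, hx, rfl⟩
  by_cases hxU : q x ∈ q '' (K ∩ U)
  · exact image_mono (inter_subset_inter_right K subset_union_left) hxU
  · exact ⟨x, ⟨hx, .inr hxU⟩, rfl⟩

theorem mem_of_mem_fibreTrim {K U : Set F} {x y : F} (hx : x ∈ fibreTrim q K U) (hxU : x ∈ U)
    (hy : y ∈ fibreTrim q K U) (hxy : q x = q y) : y ∈ U :=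
  hy.2.resolve_right (not_not_intro ⟨x, ⟨hx.1, hxU⟩, hxy⟩)

theorem isClopen_fibreTrim [TopologicalSpace F] [TopologicalSpace G] [CompactSpace F] [T2Space G]
    (hq : Continuous q) (hqo : IsOpenMap q) {K U : Set F} (hK : IsClopen K) (hU : IsClopen U) :
    IsClopen (fibreTrim q K U) := by
  have himage : IsClopen (q '' (K ∩ U)) :=
    ⟨hq.isClosedMap _ (hK.inter hU).1, hqo _ (hK.inter hU).2⟩
  exact hK.inter (hU.union (himage.preimage hq).compl)

/-- The successive trimmings of the fibres of `q` by a sequence of sets. -/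
def fibreTrimSeq (q : F → G) (U : ℕ → Set F) : ℕ → Set F
  | 0 => univ
  | l + 1 => fibreTrim q (fibreTrimSeq q U l) (U l)

theorem antitone_fibreTrimSeq (q : F → G) (U : ℕ → Set F) : Antitone (fibreTrimSeq q U) :=
  antitone_nat_of_succ_le fun l => fibreTrim_subset q _ (U l)

theorem image_fibreTrimSeq (hq : Function.Surjective q) (U : ℕ → Set F) (l : ℕ) :
    q '' fibreTrimSeq q U l = univ := by
  induction l with
  | zero => exact image_univ_of_surjective hq
  | succ l ih => exact (image_fibreTrim q _ (U l)).trans ih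

variable [TopologicalSpace F] [TopologicalSpace G] [CompactSpace F]

theorem isClopen_fibreTrimSeq [T2Space G] (hq : Continuous q) (hqo : IsOpenMap q)
    {U : ℕ → Set F} (hU : ∀ l, IsClopen (U l)) (l : ℕ) : IsClopen (fibreTrimSeq q U l) := by
  induction l with
  | zero => exact isClopen_univ
  | succ l ih => exact isClopen_fibreTrim hq hqo ih (hU l)

theorem image_iInter_of_antitone [T1Space G] (hq : Continuous q) {K : ℕ → Set F}
    (hanti : Antitone K) (hK : ∀ l, IsClosed (K l)) (himage : ∀ l, q '' K l = univ) :
    q '' ⋂ l, K l = univ := by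
  refine eq_univ_of_forall fun y => ?_
  have hclosed (l : ℕ) : IsClosed (K l ∩ q ⁻¹' {y}) :=
    (hK l).inter (isClosed_singleton.preimage hq)
  obtain ⟨x, hx⟩ := IsCompact.nonempty_iInter_of_sequence_nonempty_isCompact_isClosed
    (fun l => K l ∩ q ⁻¹' {y}) (fun l => inter_subset_inter_left _ (hanti l.le_succ))
    (fun l => (himage l).ge (mem_univ y)) (hclosed 0).isCompact hclosed
  rw [mem_iInter] at hx
  exact ⟨x, mem_iInter.2 fun l => (hx l).1, (hx 0).2⟩

theorem exists_continuous_section_of_isOpenMap [T2Space F] [TotallyDisconnectedSpace F]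
    [SecondCountableTopology F] [T2Space G] (hq : Continuous q) (hqo : IsOpenMap q)
    (hqs : Function.Surjective q) : ∃ s : C(G, F), ∀ y, q (s y) = y := by
  have : Countable (Clopens F) := Clopens.countable_iff_secondCountable.2 inferInstance
  obtain ⟨U, hU⟩ := exists_surjective_nat (Clopens F)
  let Z : Set F := ⋂ l, fibreTrimSeq q (fun l => U l) l
  have hclopen := isClopen_fibreTrimSeq hq hqo fun l => (U l).isClopen
  have hZ : IsClosed Z := isClosed_iInter fun l => (hclopen l).1
  -- Trimming by all the clopen sets leaves a single point of every fibre.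
  have hinj : InjOn q Z := fun x hx y hy hxy => by
    by_contra hne
    obtain ⟨C, hC, hxC, hyC⟩ := exists_isClopen_of_totally_separated hne
    obtain ⟨l, hl⟩ := hU ⟨C, hC⟩
    have hUl : (U l : Set F) = C := congrArg _ hl
    exact hyC (hUl ▸ mem_of_mem_fibreTrim (mem_iInter.1 hx (l + 1)) (hUl ▸ hxC)
      (mem_iInter.1 hy (l + 1)) hxy)
  have hsurj : q '' Z = univ := image_iInter_of_antitone hq (antitone_fibreTrimSeq q _)
    (fun l => (hclopen l).1) (image_fibreTrimSeq hqs _)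
  have := isCompact_iff_compactSpace.1 hZ.isCompact
  have hbij : Function.Bijective (Z.domRestrict q) :=
    ⟨hinj.injective, fun y => by simpa [domRestrict] using hsurj.ge (mem_univ y)⟩
  let e : Z ≃ₜ G := (show Continuous (Equiv.ofBijective _ hbij) from
    hq.comp continuous_subtype_val).homeoOfEquivCompactToT2
  exact ⟨⟨fun y => e.symm y, by fun_prop⟩, fun y => e.apply_symm_apply y⟩

end ContinuousSection

/-! ### Principal bundles -/

section Orbits

variable {D E B : Type*} [Group D] [MulAction D E] [TopologicalSpace E] [TopologicalSpace B]

theorem isOpenMap_of_fibres_eq_orbits [ContinuousConstSMul D E] [CompactSpace E] [T2Space B]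
    {q : E → B} (hq : Continuous q) (hqs : Function.Surjective q)
    (horb : ∀ z z', q z = q z' ↔ ∃ d : D, d • z = z') : IsOpenMap q := by
  intro O hO
  have hsaturation : q ⁻¹' (q '' O) = ⋃ d : D, (fun z => d • z) ⁻¹' O := by
    ext z
    simp only [mem_preimage, mem_image, mem_iUnion]
    constructor
    · rintro ⟨z', hz', h⟩
      obtain ⟨d, rfl⟩ := (horb z z').1 h.symm
      exact ⟨d, hz'⟩
    · rintro ⟨d, hd⟩
      exact ⟨_, hd, ((horb z _).2 ⟨d, rfl⟩).symm⟩
  rw [← (hq.isClosedMap.isQuotientMap hq hqs).isOpen_preimage, hsaturation]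
  exact isOpen_iUnion fun d => hO.preimage (continuous_const_smul d)

end Orbits

theorem continuous_of_forall_smul_eq_iff {A D E : Type*} [TopologicalSpace A] [TopologicalSpace D]
    [TopologicalSpace E] [CompactSpace D] [T2Space E] [SMul D E] [ContinuousSMul D E] {f g : A → E}
    (hf : Continuous f) (hg : Continuous g) {δ : A → D} (hδ : ∀ a d, d • f a = g a ↔ d = δ a) :
    Continuous δ := by
  rw [continuous_iff_isClosed]
  intro C hC
  have hgraph : IsClosed {w : A × D | w.2 ∈ C ∧ w.2 • f w.1 = g w.1} :=
    (hC.preimage continuous_snd).inter (isClosed_eq (by fun_prop) (by fun_prop))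
  convert isClosedMap_fst_of_compactSpace _ hgraph
  ext a
  simp [hδ]

section Trivialization

variable {D E B : Type u} [Group D] [TopologicalSpace D] [TopologicalSpace E]
  [TopologicalSpace B] [MulAction D E] {q : E → B} {V : Set B} {s : B → E}

/-- The trivialization of a free `D`-space over the domain `V` of a local section `s` of the
projection `q` to the orbit space; its second component is the function `δ` that measures the
position of a point relative to the section. -/
def sectionTrivialization [ContinuousSMul D E] (hq : Continuous q)
    (hsmul : ∀ (d : D) z, q (d • z) = q z) (hV : IsOpen V) (hs : ContinuousOn s V)
    (hqs : ∀ b ∈ V, q (s b) = b) (δ : E → D) (hδc : ContinuousOn δ (q ⁻¹' V))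
    (hδ : ∀ z, q z ∈ V → ∀ d, d • s (q z) = z ↔ d = δ z) : Bundle.Trivialization D q where
  toFun z := (q z, δ z)
  invFun w := w.2 • s w.1
  source := q ⁻¹' V
  target := V ×ˢ univ
  map_source' _ hz := ⟨hz, mem_univ _⟩
  map_target' w hw := by rwa [mem_preimage, hsmul, hqs _ hw.1, ← mem_preimage, ← prod_univ]
  left_inv' z hz := (hδ z hz _).2 rfl
  right_inv' w hw := by
    have hqw : q (w.2 • s w.1) = w.1 := (hsmul _ _).trans (hqs _ hw.1)
    exact Prod.ext hqw ((hδ _ (hqw.symm ▸ hw.1) _).1 (by rw [hqw])).symm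
  open_source := hV.preimage hq
  open_target := hV.prod isOpen_univ
  continuousOn_toFun := hq.continuousOn.prodMk hδc
  continuousOn_invFun := continuousOn_snd.smul (hs.comp continuousOn_fst fun _ hw => hw.1)
  baseSet := V
  open_baseSet := hV
  source_eq := rfl
  target_eq := rfl
  proj_toFun _ _ := rfl

theorem exists_continuousOn_smul_section_eq [CompactSpace D] [T2Space E] [ContinuousSMul D E]
    (hq : Continuous q) (horb : ∀ z z', q z = q z' ↔ ∃ d : D, d • z = z')
    (hfree : ∀ (d d' : D) (z : E), d • z = d' • z → d = d') (hs : ContinuousOn s V)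
    (hqs : ∀ b ∈ V, q (s b) = b) :
    ∃ δ : E → D, ContinuousOn δ (q ⁻¹' V) ∧ ∀ z, q z ∈ V → ∀ d, d • s (q z) = z ↔ d = δ z := by
  have hex (z : E) : ∃ d : D, q z ∈ V → d • s (q z) = z := by
    by_cases hz : q z ∈ V
    · exact ((horb _ _).1 (hqs _ hz)).imp fun _ hd _ => hd
    · exact ⟨1, fun h => absurd h hz⟩
  choose δ hδ using hex
  have hδ_iff : ∀ z, q z ∈ V → ∀ d, d • s (q z) = z ↔ d = δ z := fun z hz d =>
    ⟨fun hd => hfree _ _ _ (hd.trans (hδ z hz).symm), fun hd => hd ▸ hδ z hz⟩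
  refine ⟨δ, continuousOn_iff_continuous_domRestrict.2 ?_, hδ_iff⟩
  exact continuous_of_forall_smul_eq_iff
    (continuousOn_iff_continuous_domRestrict.1 (hs.comp hq.continuousOn (mapsTo_preimage q V)))
    continuous_subtype_val fun z => hδ_iff z z.2

theorem IsPrincipalBundle.of_local_sections [CompactSpace D] [T2Space E] [ContinuousSMul D E]
    (hq : Continuous q) (horb : ∀ z z', q z = q z' ↔ ∃ d : D, d • z = z')
    (hfree : ∀ (d d' : D) (z : E), d • z = d' • z → d = d')
    (hsec : ∀ b : B, ∃ V ∈ 𝓝 b, ∃ s : B → E, ContinuousOn s V ∧ ∀ v ∈ V, q (s v) = v) :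
    IsPrincipalBundle D q := by
  have hsmul (d : D) (z : E) : q (d • z) = q z := ((horb z _).2 ⟨d, rfl⟩).symm
  refine ⟨‹_›, hsmul, fun b => ?_⟩
  obtain ⟨W, hW, s, hs, hqs⟩ := hsec b
  obtain ⟨V, hVW, hV, hb⟩ := mem_nhds_iff.1 hW
  obtain ⟨δ, hδc, hδ⟩ :=
    exists_continuousOn_smul_section_eq hq horb hfree (hs.mono hVW) fun v hv => hqs v (hVW hv)
  refine ⟨sectionTrivialization hq hsmul hV (hs.mono hVW) (fun v hv => hqs v (hVW hv)) δ hδc hδ,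
    hb, fun d z hz => ((hδ (d • z) ((hsmul d z).symm ▸ hz) (d * δ z)).1 ?_).symm⟩
  rw [hsmul, mul_smul, (hδ z hz _).2 rfl]

end Trivialization

theorem IsUniqueFibration.exists_section_preimage {X Y B : Type u} [TopologicalSpace X]
    [TopologicalSpace Y] [TopologicalSpace B] {π : X → B} {πY : Y → B} (h : IsUniqueFibration π)
    (hY : IsUniqueFibration πY) (q : C(X, Y)) (hq : ∀ x, πY (q x) = π x) {N : Set B}
    [ContractibleSpace N] (hs : ∀ b ∈ N, ∃ s : C(πY ⁻¹' {b}, X), ∀ y, q (s y) = y) :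
    ∃ S : C(πY ⁻¹' N, X), ∀ y, q (S y) = y := by
  obtain ⟨c, ⟨K⟩⟩ := id_nullhomotopic N
  obtain ⟨s, hs⟩ := hs c c.2
  have hYc := hY.continuous
  let pr : C(πY ⁻¹' N, N) := ⟨fun y => ⟨πY y, y.2⟩, by fun_prop⟩
  -- Push `πY ⁻¹' N` into the fibre over `c`, apply `s`, and lift the way back.
  obtain ⟨H, hH, hH0⟩ := hY.exists_lift
    (⟨fun z => (K (z.1, pr z.2) : B), by fun_prop⟩ : C(I × (πY ⁻¹' N), B))
    ⟨Subtype.val, continuous_subtype_val⟩ (by simp [pr])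
  let ρ : C(πY ⁻¹' N, πY ⁻¹' {c.1}) := ⟨fun y => ⟨H (1, y), by simp [hH]⟩, by fun_prop⟩
  obtain ⟨H', hH', hH'0⟩ := h.exists_lift
    (⟨fun z => (K (σ z.1, pr z.2) : B), by fun_prop⟩ : C(I × (πY ⁻¹' N), B))
    (s.comp ρ) (fun y => by simp [← hq, hs, ρ, hH])
  refine ⟨H'.comp ⟨fun y => (1, y), by fun_prop⟩, fun y => ?_⟩
  have hback := hY.path_unique (q.comp (H'.comp ⟨fun t => (t, y), by fun_prop⟩))
    (H.comp ⟨fun t => (σ t, y), by fun_prop⟩) (fun t => by simp [hq, hH', hH])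
    (by simp [hH'0, hs, ρ])
  simpa [hH0] using DFunLike.congr_fun hback 1

/-! ### Foliation charts on bundles with totally disconnected fibre -/

section IsLeafwiseSmoothOn

variable {E T T' F : Type*} [NormedAddCommGroup E] [NormedSpace ℝ E] [TopologicalSpace T]
  [TopologicalSpace T'] [NormedAddCommGroup F] [NormedSpace ℝ F]

/-- `f` is `C^∞` on the slices `O ∩ (E × {t})`, with leafwise derivatives that are continuous
on `O`. The transition maps of a foliated atlas have this property. -/
structure IsLeafwiseSmoothOn (f : E × T → F) (O : Set (E × T)) : Prop where
  contDiffOn : ∀ t, ContDiffOn ℝ ∞ (fun v => f (v, t)) {v | (v, t) ∈ O}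
  continuousOn : ∀ k : ℕ, ContinuousOn (fun z => iteratedFDeriv ℝ k (fun v => f (v, z.2)) z.1) O

namespace IsLeafwiseSmoothOn

variable {f g : E × T → F} {O O' : Set (E × T)}

theorem mono (hf : IsLeafwiseSmoothOn f O) (hO : O' ⊆ O) : IsLeafwiseSmoothOn f O' where
  contDiffOn t := (hf.contDiffOn t).mono fun _ hv => hO hv
  continuousOn k := (hf.continuousOn k).mono hO

theorem contDiffAt (hf : IsLeafwiseSmoothOn f O) (hO : IsOpen O) {z : E × T} (hz : z ∈ O)
    (k : ℕ) : ContDiffAt ℝ k (fun v => f (v, z.2)) z.1 :=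
  ((hf.contDiffOn z.2).contDiffAt ((hO.preimage (.prodMk_left z.2)).mem_nhds hz)).of_le
    (by exact_mod_cast le_top)

theorem congr (hf : IsLeafwiseSmoothOn f O) (hO : IsOpen O) (hg : EqOn g f O) :
    IsLeafwiseSmoothOn g O where
  contDiffOn t := (hf.contDiffOn t).congr fun _ hv => hg hv
  continuousOn k := (hf.continuousOn k).congr fun z hz => by
    have hgf : (fun v => g (v, z.2)) =ᶠ[𝓝 z.1] fun v => f (v, z.2) :=
      Filter.mem_of_superset ((hO.preimage (.prodMk_left z.2)).mem_nhds hz) fun _ hv => hg hv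
    exact (hgf.iteratedFDeriv ℝ k).eq_of_nhds

theorem const_smul (hf : IsLeafwiseSmoothOn f O) (hO : IsOpen O) (r : ℝ) :
    IsLeafwiseSmoothOn (fun z => r • f z) O where
  contDiffOn t := (hf.contDiffOn t).const_smul r
  continuousOn k := ((hf.continuousOn k).const_smul r).congr fun _ hz =>
    iteratedFDeriv_const_smul_apply (hf.contDiffAt hO hz k)

theorem sub_const (hf : IsLeafwiseSmoothOn f O) (hO : IsOpen O) (b : F) :
    IsLeafwiseSmoothOn (fun z => f z - b) O where
  contDiffOn t := (hf.contDiffOn t).sub contDiffOn_const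
  continuousOn k := by
    have hb : Continuous (iteratedFDeriv ℝ k fun _ : E => b) :=
      (contDiff_const (n := (k : WithTop ℕ∞))).continuous_iteratedFDeriv le_rfl
    exact ((hf.continuousOn k).sub (hb.comp continuous_fst).continuousOn).congr fun _ hz =>
      iteratedFDeriv_sub_apply (hf.contDiffAt hO hz k) contDiffAt_const

theorem comp_rescaling (hf : IsLeafwiseSmoothOn f O) (a : E) (ρ : ℝˣ) {τ : T' → T}
    (hτ : Continuous τ) :
    IsLeafwiseSmoothOn (fun z : E × T' => f (a + (ρ : ℝ) • z.1, τ z.2))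
      ((fun z => (a + (ρ : ℝ) • z.1, τ z.2)) ⁻¹' O) where
  contDiffOn t := (hf.contDiffOn (τ t)).comp (g := fun v => f (v, τ t)) (by fun_prop)
    fun _ hv => hv
  continuousOn k := by
    let L : E ≃L[ℝ] E := ContinuousLinearEquiv.smulLeft ρ
    have hderiv (t : T) (v : E) : iteratedFDeriv ℝ k (fun v => f (a + (ρ : ℝ) • v, t)) v =
        ContinuousMultilinearMap.compContinuousLinearMapL (fun _ => (L : E →L[ℝ] E))
          (iteratedFDeriv ℝ k (fun v => f (v, t)) (a + (ρ : ℝ) • v)) := by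
      have h := L.iteratedFDerivWithin_comp_right (fun v => f (a + v, t)) uniqueDiffOn_univ
        (x := v) (mem_univ _) k
      rwa [preimage_univ, iteratedFDerivWithin_univ, iteratedFDerivWithin_univ,
        iteratedFDeriv_comp_add_left (f := fun v => f (v, t))] at h
    have hcont : Continuous fun z : E × T' => (a + (ρ : ℝ) • z.1, τ z.2) := by fun_prop
    simp only [hderiv]
    exact (ContinuousLinearMap.continuous _).comp_continuousOn
      ((hf.continuousOn k).comp hcont.continuousOn fun _ hz => hz)

end IsLeafwiseSmoothOn

end IsLeafwiseSmoothOn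

theorem isOpen_setOf_forall_mem_Ioo (n : ℕ) :
    IsOpen {v : EuclideanSpace ℝ (Fin n) | ∀ i, v i ∈ Ioo (-1 : ℝ) 1} := by
  rw [ofPred_forall]
  exact isOpen_iInter_of_finite fun _ => isOpen_Ioo.preimage (by fun_prop)

theorem norm_le_sqrt_of_forall_mem_Ioo {n : ℕ} {v : EuclideanSpace ℝ (Fin n)}
    (hv : ∀ i, v i ∈ Ioo (-1 : ℝ) 1) : ‖v‖ ≤ Real.sqrt n := by
  rw [EuclideanSpace.norm_eq]
  refine Real.sqrt_le_sqrt ?_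
  calc ∑ i, ‖v i‖ ^ 2 ≤ ∑ _i : Fin n, (1 : ℝ) := Finset.sum_le_sum fun i _ => by
        rw [Real.norm_eq_abs, sq_abs, sq_le_one_iff_abs_le_one]
        exact abs_le.2 ⟨(hv i).1.le, (hv i).2.le⟩
    _ = n := by simp

theorem exists_rescaled_cube_subset {n : ℕ} {U : Set (EuclideanSpace ℝ (Fin n))}
    {a : EuclideanSpace ℝ (Fin n)} (hU : U ∈ 𝓝 a) :
    ∃ ρ : ℝˣ, ∀ v : EuclideanSpace ℝ (Fin n), (∀ i, v i ∈ Ioo (-1 : ℝ) 1) →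
      a + (ρ : ℝ) • v ∈ U := by
  obtain ⟨ε, hε, hεU⟩ := Metric.mem_nhds_iff.1 hU
  have hr : 0 < ε / (Real.sqrt n + 1) := by positivity
  refine ⟨Units.mk0 _ hr.ne', fun v hv => hεU ?_⟩
  rw [Metric.mem_ball, dist_eq_norm, add_sub_cancel_left, norm_smul, Real.norm_eq_abs,
    Units.val_mk0, abs_of_pos hr, div_mul_eq_mul_div, div_lt_iff₀ (by positivity)]
  have := norm_le_sqrt_of_forall_mem_Ioo hv
  gcongr
  linarith

theorem exists_rescaled_cube_prod_isClopen_subset {n : ℕ} {T : Type*} [TopologicalSpace T]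
    [CompactSpace T] [T2Space T] [TotallyDisconnectedSpace T] {a : EuclideanSpace ℝ (Fin n)}
    {t : T} {S : Set (EuclideanSpace ℝ (Fin n) × T)} (hS : S ∈ 𝓝 (a, t)) :
    ∃ (ρ : ℝˣ) (T' : Set T), IsClopen T' ∧ t ∈ T' ∧
      ∀ v : EuclideanSpace ℝ (Fin n), (∀ i, v i ∈ Ioo (-1 : ℝ) 1) → ∀ t' ∈ T',
        (a + (ρ : ℝ) • v, t') ∈ S := by
  rw [nhds_prod_eq, Filter.mem_prod_iff] at hS
  obtain ⟨U, hU, V, hV, hUV⟩ := hS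
  obtain ⟨ρ, hρ⟩ := exists_rescaled_cube_subset hU
  obtain ⟨V', hV'V, hV'o, htV'⟩ := mem_nhds_iff.1 hV
  obtain ⟨T', hT', htT', hT'V⟩ := compact_exists_isClopen_in_isOpen hV'o htV'
  exact ⟨ρ, T', hT', htT', fun v hv t' ht' => hUV ⟨hρ v hv, hV'V (hT'V ht')⟩⟩

namespace FoliationChart

variable {n : ℕ} {X Y Z : Type u} [TopologicalSpace X] [TopologicalSpace Y] [TopologicalSpace Z]

theorem t2Space [T2Space Y] (c : FoliationChart n Y) : T2Space c.T := by
  have hmem (t : c.T) : ((0 : EuclideanSpace ℝ (Fin n)), t) ∈ c.chart.target := by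
    rw [c.target_eq]
    exact ⟨fun _ => by simp, mem_univ _⟩
  refine T2Space.of_injective_continuous (f := fun t : c.T => c.chart.symm (0, t))
    (fun t t' htt' => congrArg Prod.snd (c.chart.symm.injOn (hmem t) (hmem t') htt')) ?_
  exact c.chart.continuousOn_symm.comp_continuous (by fun_prop) hmem

theorem isOpen_overlap (c c' : FoliationChart n X) : IsOpen (c.overlap c') :=
  (c.chart.symm.trans c'.chart).open_source

theorem mem_overlap_iff {c c' : FoliationChart n X} {z : EuclideanSpace ℝ (Fin n) × c.T} :
    z ∈ c.overlap c' ↔ z ∈ c.chart.target ∧ c.chart.symm z ∈ c'.chart.source := by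
  simp [overlap]

theorem smoothTransition_iff {c c' : FoliationChart n X} :
    c.SmoothTransition c' ↔ IsLeafwiseSmoothOn (c.leafTransition c') (c.overlap c') :=
  ⟨fun h => ⟨h.contDiffOn, h.continuousOn⟩, fun h => ⟨h.contDiffOn, h.continuousOn⟩⟩

/-- In the coordinates of `c'` and `c`, the map `q` is a rescaling and translation of the leaf
coordinate and a continuous map of the transversals. Charts that are pulled back from smoothly
compatible charts are smoothly compatible. -/
def IsPullback (q : X → Y) (c' : FoliationChart n X) (c : FoliationChart n Y) : Prop :=
  ∃ (a : EuclideanSpace ℝ (Fin n)) (ρ : ℝˣ) (τ : c'.T → c.T), Continuous τ ∧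
    ∀ z ∈ c'.chart.target, (a + (ρ : ℝ) • z.1, τ z.2) ∈ c.chart.target ∧
      q (c'.chart.symm z) = c.chart.symm (a + (ρ : ℝ) • z.1, τ z.2)

theorem IsPullback.trans {q : X → Y} {r : Y → Z} {c'' : FoliationChart n X}
    {c' : FoliationChart n Y} {c : FoliationChart n Z} (hq : IsPullback q c'' c')
    (hr : IsPullback r c' c) : IsPullback (r ∘ q) c'' c := by
  obtain ⟨a, ρ, τ, hτ, h⟩ := hq
  obtain ⟨a', ρ', τ', hτ', h'⟩ := hr
  refine ⟨a' + (ρ' : ℝ) • a, ρ' * ρ, τ' ∘ τ, hτ'.comp hτ, fun z hz => ?_⟩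
  have haff : a' + (ρ' : ℝ) • a + ((ρ' * ρ : ℝˣ) : ℝ) • z.1 =
      a' + (ρ' : ℝ) • (a + (ρ : ℝ) • z.1) := by
    rw [Units.val_mul, smul_add, mul_smul, add_assoc]
  rw [haff, Function.comp_apply (f := r), (h z hz).2]
  exact h' _ (h z hz).1

theorem SmoothTransition.of_isPullback {q : X → Y} {c₁' c₂' : FoliationChart n X}
    {c₁ c₂ : FoliationChart n Y} (h₁ : IsPullback q c₁' c₁) (h₂ : IsPullback q c₂' c₂)
    (h : c₁.SmoothTransition c₂) : c₁'.SmoothTransition c₂' := by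
  obtain ⟨a₁, ρ₁, τ₁, hτ₁, hq₁⟩ := h₁
  obtain ⟨a₂, ρ₂, τ₂, -, hq₂⟩ := h₂
  have htransition : ∀ z ∈ c₁'.overlap c₂', (a₁ + (ρ₁ : ℝ) • z.1, τ₁ z.2) ∈ c₁.overlap c₂ ∧
      c₁'.leafTransition c₂' z =
        (ρ₂ : ℝ)⁻¹ • (c₁.leafTransition c₂ (a₁ + (ρ₁ : ℝ) • z.1, τ₁ z.2) - a₂) := by
    intro z hz
    rw [mem_overlap_iff] at hz
    obtain ⟨hz₁, hqz₁⟩ := hq₁ z hz.1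
    obtain ⟨hz₂, hqz₂⟩ := hq₂ _ (c₂'.chart.map_source hz.2)
    rw [c₂'.chart.left_inv hz.2, hqz₁] at hqz₂
    refine ⟨mem_overlap_iff.2 ⟨hz₁, hqz₂ ▸ c₂.chart.map_target hz₂⟩, ?_⟩
    rw [leafTransition, leafTransition, hqz₂, c₂.chart.right_inv hz₂, add_sub_cancel_left,
      inv_smul_smul₀ ρ₂.ne_zero]
  have hopen := c₁'.isOpen_overlap c₂'
  rw [smoothTransition_iff] at h ⊢
  exact ((((h.comp_rescaling a₁ ρ₁ hτ₁).mono fun z hz => (htransition z hz).1).sub_const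
    hopen a₂).const_smul hopen (ρ₂ : ℝ)⁻¹).congr hopen fun z hz => (htransition z hz).2

theorem exists_isPullback_id [T2Space Y] (c : FoliationChart n Y) {y : Y}
    (hy : y ∈ c.chart.source) {W : Set Y} (hW : W ∈ 𝓝 y) :
    ∃ c₀ : FoliationChart n Y, y ∈ c₀.chart.source ∧ c₀.chart.source ⊆ W ∧
      IsPullback id c₀ c := by
  have := c.t2Space
  obtain ⟨⟨a, t⟩, ht, rfl⟩ : ∃ p ∈ c.chart.target, c.chart.symm p = y :=
    ⟨_, c.chart.map_source hy, c.chart.left_inv hy⟩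
  have hpW : c.chart.target ∩ c.chart.symm ⁻¹' W ∈ 𝓝 (a, t) :=
    Filter.inter_mem (c.chart.open_target.mem_nhds ht) (c.chart.symm.continuousAt ht hW)
  obtain ⟨ρ, T', hT', htT', hbox⟩ := exists_rescaled_cube_prod_isClopen_subset hpW
  have : CompactSpace T' := isCompact_iff_compactSpace.1 hT'.1.isCompact
  let A : EuclideanSpace ℝ (Fin n) ≃ₜ EuclideanSpace ℝ (Fin n) :=
    (Homeomorph.smulOfNeZero (ρ : ℝ) ρ.ne_zero).trans (Homeomorph.addLeft a)
  have hA : IsOpenEmbedding (Prod.map A ((↑) : T' → c.T)) :=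
    A.isOpenEmbedding.prodMap hT'.2.isOpenEmbedding_subtypeVal
  have : Nonempty (EuclideanSpace ℝ (Fin n) × T') := ⟨(0, ⟨t, htT'⟩)⟩
  let F : OpenPartialHomeomorph (EuclideanSpace ℝ (Fin n) × T') Y :=
    ((hA.toOpenPartialHomeomorph _).restrOpen _
      ((isOpen_setOf_forall_mem_Ioo n).prod isOpen_univ)).trans c.chart.symm
  have hFs : F.source = {v | ∀ i, v i ∈ Ioo (-1 : ℝ) 1} ×ˢ univ :=
    Subset.antisymm (fun _ hz => hz.1.2)
      fun z hz => ⟨⟨mem_univ _, hz⟩, (hbox z.1 hz.1 z.2 z.2.2).1⟩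
  have hF (z) (hz : z ∈ F.source) :
      (a + (ρ : ℝ) • z.1, (z.2 : c.T)) ∈ c.chart.target ∩ c.chart.symm ⁻¹' W :=
    hbox z.1 (hFs.subset hz).1 z.2 z.2.2
  refine ⟨{ T := T', chart := F.symm, target_eq := hFs }, ?_, fun y' hy' => ?_, a, ρ, (↑),
    continuous_subtype_val, fun z hz => ⟨(hF z hz).1, rfl⟩⟩
  · have h0 : ((0, ⟨t, htT'⟩) : EuclideanSpace ℝ (Fin n) × T') ∈ F.source := by
      rw [hFs]
      exact ⟨fun _ => by simp, mem_univ _⟩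
    have hF0 : F (0, ⟨t, htT'⟩) = c.chart.symm (a, t) := by
      change c.chart.symm (a + (ρ : ℝ) • 0, t) = _
      rw [smul_zero, add_zero]
    exact hF0 ▸ F.map_source h0
  · rw [← F.right_inv hy']
    exact (hF _ (F.map_target hy')).2

theorem exists_isPullback_of_source_subset {D : Type u} [TopologicalSpace D] [CompactSpace D]
    [TotallyDisconnectedSpace D] {q : X → Y} (c : FoliationChart n Y)
    (e : Bundle.Trivialization D q) (hce : c.chart.source ⊆ e.baseSet) {x : X}
    (hx : q x ∈ c.chart.source) :
    ∃ c' : FoliationChart n X, x ∈ c'.chart.source ∧ IsPullback q c' c := by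
  let F : OpenPartialHomeomorph X (EuclideanSpace ℝ (Fin n) × (c.T × D)) :=
    (e.toOpenPartialHomeomorph.trans (c.chart.prod (OpenPartialHomeomorph.refl D))).trans
      (Homeomorph.prodAssoc _ _ _).toOpenPartialHomeomorph
  have hmem {z : EuclideanSpace ℝ (Fin n) × (c.T × D)} (hz : (z.1, z.2.1) ∈ c.chart.target) :
      (c.chart.symm (z.1, z.2.1), z.2.2) ∈ e.target :=
    e.mem_target.2 (hce (c.chart.map_target hz))
  have hFt : F.target = {v | ∀ i, v i ∈ Ioo (-1 : ℝ) 1} ×ˢ univ := by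
    ext z
    have hz : (z.1, z.2.1) ∈ c.chart.target ↔ ∀ i, z.1 i ∈ Ioo (-1 : ℝ) 1 := by
      simp [c.target_eq]
    constructor
    · exact fun h => ⟨hz.1 h.2.1.1, mem_univ _⟩
    · exact fun h => ⟨mem_univ _, ⟨hz.2 h.1, mem_univ _⟩, hmem (hz.2 h.1)⟩
  refine ⟨{ T := c.T × D, chart := F, target_eq := hFt }, ?_, 0, 1, Prod.fst, continuous_fst,
    fun z hz => ?_⟩
  · have hex : (e x).1 ∈ c.chart.source := (e.coe_fst' (hce hx)).symm ▸ hx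
    exact ⟨⟨e.mem_source.2 (hce hx), hex, mem_univ _⟩, mem_univ _⟩
  · have hz' : (z.1, z.2.1) ∈ c.chart.target := hz.2.1.1
    rw [Units.val_one, one_smul, zero_add]
    exact ⟨hz', e.proj_symm_apply (hmem hz')⟩

theorem exists_isPullback {D : Type u} [TopologicalSpace D] [CompactSpace D]
    [TotallyDisconnectedSpace D] [T2Space Y] {q : X → Y} (c : FoliationChart n Y)
    (e : Bundle.Trivialization D q) {x : X} (hc : q x ∈ c.chart.source) (he : q x ∈ e.baseSet) :
    ∃ c' : FoliationChart n X, x ∈ c'.chart.source ∧ IsPullback q c' c := by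
  obtain ⟨c₀, hx, hc₀e, hc₀⟩ := c.exists_isPullback_id hc (e.open_baseSet.mem_nhds he)
  obtain ⟨c', hxc', hc'⟩ := c₀.exists_isPullback_of_source_subset e hc₀e hx
  exact ⟨c', hxc', hc'.trans hc₀⟩

end FoliationChart

theorem IsMatchboxManifold.of_trivialization {n : ℕ} {X Y D : Type u} [TopologicalSpace X]
    [TopologicalSpace Y] [TopologicalSpace D] [CompactSpace D] [TotallyDisconnectedSpace D]
    (hY : IsMatchboxManifold n Y) [CompactSpace X] [ConnectedSpace X] [MetrizableSpace X]
    {q : X → Y} (hq : ∀ y, ∃ e : Bundle.Trivialization D q, y ∈ e.baseSet) :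
    IsMatchboxManifold n X := by
  have := hY.metrizableSpace
  obtain ⟨A, hA, hAs⟩ := hY.exists_atlas
  refine ⟨inferInstance, inferInstance, inferInstance,
    {c' | ∃ c ∈ A, FoliationChart.IsPullback q c' c}, fun x => ?_, ?_⟩
  · obtain ⟨c, hc, hxc⟩ := hA (q x)
    obtain ⟨e, he⟩ := hq (q x)
    obtain ⟨c', hxc', hcc'⟩ := c.exists_isPullback e hxc he
    exact ⟨c', ⟨c, hc, hcc'⟩, hxc'⟩
  · rintro c₁' ⟨c₁, hc₁, h₁⟩ c₂' ⟨c₂, hc₂, h₂⟩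
    exact .of_isPullback h₁ h₂ (hAs c₁ hc₁ c₂ hc₂)

/-! ### Monodromy -/

section Monodromy

variable {E E' B : Type*} [TopologicalSpace E] [TopologicalSpace E'] [TopologicalSpace B]

theorem map_monodromy_eq_monodromy {π : E → B} {π' : E' → B} (cov : IsCoveringMap π)
    (cov' : IsCoveringMap π') (p : C(E', E)) (hp : ∀ e, π (p e) = π' e) {x y : B}
    (γ : Path.Homotopic.Quotient x y) {e' : π' ⁻¹' {x}} {e : π ⁻¹' {x}} (he : p e' = e) :
    p (cov'.monodromy γ e') = cov.monodromy γ e := by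
  obtain ⟨γ⟩ := γ
  have h : p.comp (cov'.liftPath γ e' (γ.source.trans e'.2.symm)) =
      cov.liftPath γ e (γ.source.trans e.2.symm) := by
    refine (cov.eq_liftPath_iff' _).2 ⟨funext fun t => ?_, ?_⟩
    · exact (hp _).trans <| congrFun (cov'.liftPath_lifts _ _ (γ.source.trans e'.2.symm)) t
    · rw [ContinuousMap.comp_apply, cov'.liftPath_zero, he]
  exact DFunLike.congr_fun h 1

theorem exists_monodromy_eq [PathConnectedSpace E] {π : E → B} (cov : IsCoveringMap π) {x y : B}
    (e : π ⁻¹' {x}) (e' : π ⁻¹' {y}) :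
    ∃ γ : Path.Homotopic.Quotient x y, cov.monodromy γ e = e' := by
  obtain ⟨e, rfl⟩ := e
  obtain ⟨e', rfl⟩ := e'
  exact ⟨_, cov.monodromy_map (.mk (PathConnectedSpace.somePath e e'))⟩

variable {π : C(E, B)} (cov : IsCoveringMap π)
include cov

theorem mem_range_mapOfEq_iff_monodromy_eq {b : B} {e : E} (he : π e = b)
    (g : FundamentalGroup B b) :
    g ∈ (FundamentalGroup.mapOfEq π he).range ↔ cov.monodromy g ⟨e, he⟩ = ⟨e, he⟩ := by
  subst he
  constructor
  · rintro ⟨γ, rfl⟩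
    rw [FundamentalGroup.mapOfEq_apply]
    change cov.monodromy (Path.Homotopic.Quotient.cast _ rfl rfl) _ = _
    rw [Path.Homotopic.Quotient.cast_rfl_rfl]
    exact cov.monodromy_map γ
  · intro h
    refine ⟨(cov.liftPathQuotient g ⟨e, rfl⟩).cast rfl congr($h.symm), ?_⟩
    rw [FundamentalGroup.mapOfEq_apply, Path.Homotopic.Quotient.map_cast,
      show Path.Homotopic.Quotient.map _ π = _ from cov.map_liftPathQuotient g ⟨e, rfl⟩]
    exact (Path.Homotopic.Quotient.cast_cast _ _ _ _ _).trans <|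
      (Path.Homotopic.Quotient.cast_cast _ _ _ _ _).trans
        (Path.Homotopic.Quotient.cast_rfl_rfl _)

theorem normalCore_range_mapOfEq_eq_ker_monodromyPerm [PathConnectedSpace E] {b : B} {e : E}
    (he : π e = b) :
    (FundamentalGroup.mapOfEq π he).range.normalCore = (cov.monodromyPerm b).ker := by
  have conj_mem_iff (g k : FundamentalGroup B b) :
      k * g * k⁻¹ ∈ (FundamentalGroup.mapOfEq π he).range ↔
        cov.monodromyPerm b g ((cov.monodromyPerm b k)⁻¹ ⟨e, he⟩) =
          (cov.monodromyPerm b k)⁻¹ ⟨e, he⟩ := by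
    rw [mem_range_mapOfEq_iff_monodromy_eq cov he, ← cov.coe_monodromyPerm, map_mul, map_mul,
      map_inv, Equiv.Perm.mul_apply, Equiv.Perm.mul_apply, Equiv.Perm.eq_inv_iff_eq]
  ext g
  rw [MonoidHom.mem_ker]
  constructor
  · intro hg
    ext1 a
    obtain ⟨k, hk⟩ := exists_monodromy_eq cov ⟨e, he⟩ a
    have hfix := (conj_mem_iff g (k : FundamentalGroup B b)⁻¹).1 (hg _)
    rwa [map_inv, inv_inv, cov.coe_monodromyPerm (γ := k), hk] at hfix
  · intro hg k
    rw [conj_mem_iff, hg]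
    rfl

end Monodromy

/-! ### The Galois closure of a covering -/

section FibreTuple

variable {M B : Type u} [TopologicalSpace M] [TopologicalSpace B]

/-- The families of points of `M`, indexed by the fibre of `π` over `b`, that lie over a common
point. -/
def FibreTuple (π : C(M, B)) (b : B) : Type u :=
  {f : π ⁻¹' {b} → M // ∀ a a', π (f a) = π (f a')}

instance (π : C(M, B)) (b : B) : TopologicalSpace (FibreTuple π b) :=
  inferInstanceAs (TopologicalSpace {f : π ⁻¹' {b} → M // ∀ a a', π (f a) = π (f a')})

namespace FibreTuple

variable {π : C(M, B)} {b : B}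

instance [T2Space M] : T2Space (FibreTuple π b) :=
  inferInstanceAs (T2Space {f : π ⁻¹' {b} → M // ∀ a a', π (f a) = π (f a')})

instance [CompactSpace M] [T2Space B] : CompactSpace (FibreTuple π b) := by
  refine isCompact_iff_compactSpace.1 (IsClosed.isCompact
    (s := {f : π ⁻¹' {b} → M | ∀ a a', π (f a) = π (f a')}) ?_)
  simp only [ofPred_forall]
  exact isClosed_iInter fun a => isClosed_iInter fun a' => isClosed_eq (by fun_prop) (by fun_prop)

theorem continuous_eval (a : π ⁻¹' {b}) : Continuous fun f : FibreTuple π b => f.1 a :=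
  (continuous_apply a).comp continuous_subtype_val

variable (π b) in
/-- The inclusion of the fibre over `b`, as a fibre tuple. -/
def inclusion : FibreTuple π b :=
  ⟨Subtype.val, fun a a' => a.2.trans a'.2.symm⟩

open Classical in
/-- The tuple of the values of the inverse branches `φ a` at a point `v` of their common domain
(and the inclusion of the fibre at any other point). -/
noncomputable def ofBranches (φ : π ⁻¹' {b} → OpenPartialHomeomorph M B)
    (hφ : ∀ a m, φ a m = π m) (v : B) : FibreTuple π b :=
  if hv : v ∈ ⋂ a, (φ a).target then
    Subtype.mk (fun a => (φ a).symm v) fun a a' => by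
      rw [← hφ a, ← hφ a', (φ a).right_inv (mem_iInter.1 hv a),
        (φ a').right_inv (mem_iInter.1 hv a')]
  else inclusion π b

theorem ofBranches_apply {φ : π ⁻¹' {b} → OpenPartialHomeomorph M B} (hφ : ∀ a m, φ a m = π m)
    {v : B} (hv : v ∈ ⋂ a, (φ a).target) (a : π ⁻¹' {b}) :
    (ofBranches φ hφ v).1 a = (φ a).symm v :=
  congrArg (fun f : FibreTuple π b => f.1 a) (dif_pos hv)

/-- The projection of fibre tuples to the base, as a homeomorphism on the tuples whose `a`-th entry
lies in the domain of the branch `φ a` of `π`. -/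
noncomputable def chartOfBranches [Finite (π ⁻¹' {b})]
    (φ : π ⁻¹' {b} → OpenPartialHomeomorph M B) (hφ : ∀ a m, φ a m = π m) (a₀ : π ⁻¹' {b}) :
    OpenPartialHomeomorph (FibreTuple π b) B :=
  have proj_mem (f : FibreTuple π b) (hf : ∀ a, f.1 a ∈ (φ a).source) :
      π (f.1 a₀) ∈ ⋂ a, (φ a).target := mem_iInter.2 fun a => by
    rw [f.2 a₀ a, ← hφ a]
    exact (φ a).map_source (hf a)
  { toFun := fun f => π (f.1 a₀)
    invFun := ofBranches φ hφ
    source := {f | ∀ a, f.1 a ∈ (φ a).source}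
    target := ⋂ a, (φ a).target
    map_source' := proj_mem
    map_target' := fun v hv a => by
      rw [ofBranches_apply hφ hv]
      exact (φ a).map_target (mem_iInter.1 hv a)
    left_inv' := fun f hf => by
      refine Subtype.ext (funext fun a => ?_)
      rw [ofBranches_apply hφ (proj_mem f hf), f.2 a₀ a, ← hφ a, (φ a).left_inv (hf a)]
    right_inv' := fun v hv => by
      rw [ofBranches_apply hφ hv, ← hφ a₀, (φ a₀).right_inv (mem_iInter.1 hv a₀)]
    open_source := by
      rw [ofPred_forall]
      exact isOpen_iInter_of_finite fun a => (φ a).open_source.preimage (continuous_eval a)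
    open_target := isOpen_iInter_of_finite fun a => (φ a).open_target
    continuousOn_toFun := (π.continuous.comp (continuous_eval a₀)).continuousOn
    continuousOn_invFun := IsInducing.subtypeVal.continuousOn_iff.2 <| continuousOn_pi.2 fun a =>
      ((φ a).continuousOn_symm.mono (iInter_subset _ a)).congr fun _ hv =>
        ofBranches_apply hφ hv a }

theorem isLocalHomeomorph [Finite (π ⁻¹' {b})] (hπ : IsLocalHomeomorph π) (a : π ⁻¹' {b}) :
    IsLocalHomeomorph fun f : FibreTuple π b => π (f.1 a) := by
  refine IsLocalHomeomorph.mk _ fun f => ?_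
  choose φ hφ hφπ using fun a' => hπ (f.1 a')
  exact ⟨chartOfBranches φ (fun a' m => by rw [hφπ a']) a, hφ, fun _ _ => rfl⟩

end FibreTuple

/-- The charts of `Y` pulled back by a local homeomorphism `X → Y`. -/
@[reducible]
noncomputable def chartedSpaceOfIsLocalHomeomorph {H X Y : Type*} [TopologicalSpace H]
    [TopologicalSpace X] [TopologicalSpace Y] [ChartedSpace H Y] {f : X → Y}
    (hf : IsLocalHomeomorph f) : ChartedSpace H X where
  atlas := range fun x => (hf x).choose.trans (chartAt H (f x))
  chartAt x := (hf x).choose.trans (chartAt H (f x))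
  mem_chart_source x := by
    obtain ⟨hx, hfx⟩ := (hf x).choose_spec
    rw [OpenPartialHomeomorph.trans_source]
    refine ⟨hx, ?_⟩
    rw [mem_preimage, ← hfx]
    exact mem_chart_source H (f x)
  chart_mem_atlas x := mem_range_self x

/-- The total space of the Galois closure of the covering `π`, with respect to the base point `b`:
the path component of the inclusion in the space of fibre tuples. -/
def GaloisClosure (π : C(M, B)) (b : B) : Type u :=
  {f : FibreTuple π b // f ∈ pathComponent (FibreTuple.inclusion π b)}

instance (π : C(M, B)) (b : B) : TopologicalSpace (GaloisClosure π b) :=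
  inferInstanceAs (TopologicalSpace {f // f ∈ pathComponent (FibreTuple.inclusion π b)})

namespace GaloisClosure

variable {π : C(M, B)} {b : B}

/-- The evaluation at a point of the fibre, which is the covering of `M` by the Galois closure. -/
def eval (a : π ⁻¹' {b}) : C(GaloisClosure π b, M) :=
  ⟨fun f => f.1.1 a, (FibreTuple.continuous_eval a).comp continuous_subtype_val⟩

@[ext]
theorem ext {f f' : GaloisClosure π b} (h : ∀ a, eval a f = eval a f') : f = f' :=
  Subtype.ext (Subtype.ext (funext h))

theorem proj_eval (a a' : π ⁻¹' {b}) (f : GaloisClosure π b) : π (eval a f) = π (eval a' f) :=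
  f.1.2 a a'

variable (π b) in
/-- The base point of the Galois closure: the inclusion of the fibre. -/
def base : GaloisClosure π b :=
  ⟨FibreTuple.inclusion π b, mem_pathComponent_self _⟩

theorem continuous_iff {A : Type*} [TopologicalSpace A] {f : A → GaloisClosure π b} :
    Continuous f ↔ ∀ a, Continuous fun x => eval a (f x) :=
  ⟨fun h a => (eval a).continuous.comp h,
    fun h => ((continuous_pi h).subtype_mk _).subtype_mk _⟩

instance [T2Space M] : T2Space (GaloisClosure π b) :=
  inferInstanceAs (T2Space {f // f ∈ pathComponent (FibreTuple.inclusion π b)})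

instance : PathConnectedSpace (GaloisClosure π b) :=
  isPathConnected_iff_pathConnectedSpace.1 isPathConnected_pathComponent

section LocallyPathConnected

variable [LocallyPathConnectedSpace B] [Finite (π ⁻¹' {b})]

theorem isClopen_pathComponent_inclusion (hπ : IsLocalHomeomorph π) (a : π ⁻¹' {b}) :
    IsClopen (pathComponent (FibreTuple.inclusion π b)) := by
  let _ := chartedSpaceOfIsLocalHomeomorph (H := B) (FibreTuple.isLocalHomeomorph hπ a)
  have := ChartedSpace.locallyPathConnectedSpace B (FibreTuple π b)
  exact ⟨IsClosed.pathComponent _, IsOpen.pathComponent _⟩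

theorem compactSpace [CompactSpace M] [T2Space B] (hπ : IsLocalHomeomorph π) (a : π ⁻¹' {b}) :
    CompactSpace (GaloisClosure π b) :=
  isCompact_iff_compactSpace.1 (isClopen_pathComponent_inclusion hπ a).1.isCompact

theorem isLocalHomeomorph_comp_eval (hπ : IsLocalHomeomorph π) (a : π ⁻¹' {b}) :
    IsLocalHomeomorph (π.comp (eval a)) :=
  (FibreTuple.isLocalHomeomorph hπ a).comp
    (isClopen_pathComponent_inclusion hπ a).2.isOpenEmbedding_subtypeVal.isLocalHomeomorph

end LocallyPathConnected

section Monodromy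

variable (cov : IsCoveringMap π)

/-- The point of the Galois closure to which the base point is moved along a path in the base. -/
noncomputable def ofPath {m : B} (α : Path.Homotopic.Quotient b m) : GaloisClosure π b :=
  ⟨⟨fun a => cov.monodromy α a, fun a a' =>
    (cov.monodromy α a).2.trans (cov.monodromy α a').2.symm⟩, by
    obtain ⟨γ⟩ := α
    have h (a : π ⁻¹' {b}) : γ 0 = π a := γ.source.trans a.2.symm
    have hl (a : π ⁻¹' {b}) (t : I) : π (cov.liftPath γ a (h a) t) = γ t :=
      congrFun (cov.liftPath_lifts γ a (h a)) t
    exact ⟨⟨⟨fun t => ⟨fun a => cov.liftPath γ a (h a) t, fun a a' => by rw [hl, hl]⟩,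
        (continuous_pi fun a : π ⁻¹' {b} => (cov.liftPath γ a (h a)).continuous).subtype_mk _⟩,
      Subtype.ext (funext fun a : π ⁻¹' {b} => cov.liftPath_zero γ a (h a)), rfl⟩⟩⟩

@[simp]
theorem eval_ofPath {m : B} (α : Path.Homotopic.Quotient b m) (a : π ⁻¹' {b}) :
    eval a (ofPath cov α) = cov.monodromy α a :=
  rfl

theorem exists_eq_ofPath (f : GaloisClosure π b) (a : π ⁻¹' {b}) {m : B} (hm : π (eval a f) = m) :
    ∃ α : Path.Homotopic.Quotient b m, f = ofPath cov α := by
  obtain ⟨f, ⟨Γ⟩⟩ := f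
  subst hm
  have hΓ0 (a' : π ⁻¹' {b}) : (Γ 0).1 a' = a' := by
    rw [Γ.source]
    rfl
  have hΓ (a' : π ⁻¹' {b}) : Continuous fun t => (Γ t).1 a' :=
    (FibreTuple.continuous_eval a').comp Γ.continuous
  let γ : Path b (π (f.1 a)) := ⟨⟨fun t => π ((Γ t).1 a), π.continuous.comp (hΓ a)⟩,
    (congrArg π (hΓ0 a)).trans a.2, congrArg (fun f => π (f.1 a)) Γ.target⟩
  refine ⟨.mk γ, ext fun a' => ?_⟩
  have hlift : ⟨fun t => (Γ t).1 a', hΓ a'⟩ = cov.liftPath γ a' (γ.source.trans a'.2.symm) :=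
    (cov.eq_liftPath_iff' _).2 ⟨funext fun t => (Γ t).2 a' a, hΓ0 a'⟩
  exact (congrArg (fun f => f.1 a') Γ.target).symm.trans (DFunLike.congr_fun hlift 1)

include cov in
theorem injective_eval (f : GaloisClosure π b) : Function.Injective fun a => eval a f := by
  intro a a' haa'
  obtain ⟨m, hm⟩ : ∃ m, π (eval a f) = m := ⟨_, rfl⟩
  obtain ⟨α, rfl⟩ := exists_eq_ofPath cov f a hm
  exact (cov.monodromy_bijective α).1 (Subtype.ext haa')

/-- The monodromy group acts on the Galois closure by reindexing the tuples. -/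
noncomputable instance : MulAction (cov.monodromyPerm b).range (GaloisClosure π b) where
  smul s f := ⟨⟨fun a => eval (s.1⁻¹ a) f, fun _ _ => proj_eval _ _ f⟩, by
    obtain ⟨_, g, rfl⟩ := s
    let r (f' : FibreTuple π b) : FibreTuple π b :=
      ⟨fun a => f'.1 ((cov.monodromyPerm b g)⁻¹ a), fun _ _ => f'.2 _ _⟩
    have hr : Continuous r :=
      (continuous_pi fun a => FibreTuple.continuous_eval _).subtype_mk _
    have hbase : (ofPath cov (g⁻¹ : FundamentalGroup B b)).1 = r (FibreTuple.inclusion π b) :=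
      Subtype.ext <| funext fun a => congrArg (fun s : Equiv.Perm (π ⁻¹' {b}) => (s a).1)
        (map_inv (cov.monodromyPerm b) g)
    exact (hbase ▸ (ofPath cov (g⁻¹ : FundamentalGroup B b)).2 :).trans (f.2.map hr)⟩
  one_smul _ := rfl
  mul_smul s t f := ext fun a => by
    change eval ((s * t).1⁻¹ a) f = eval (t.1⁻¹ (s.1⁻¹ a)) f
    rw [Subgroup.coe_mul, mul_inv_rev, Equiv.Perm.mul_apply]

theorem eval_smul (s : (cov.monodromyPerm b).range) (f : GaloisClosure π b) (a : π ⁻¹' {b}) :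
    eval a (s • f) = eval (s.1⁻¹ a) f :=
  rfl

instance : ContinuousConstSMul (cov.monodromyPerm b).range (GaloisClosure π b) where
  continuous_const_smul s := continuous_iff.2 fun a => (eval (s.1⁻¹ a)).continuous

theorem eval_smul_eq_iff (s : (cov.monodromyPerm b).range) (f : GaloisClosure π b)
    (a : π ⁻¹' {b}) : eval a (s • f) = eval a f ↔ s.1 a = a := by
  rw [eval_smul, (injective_eval cov f).eq_iff, Equiv.Perm.inv_eq_iff_eq, eq_comm]

theorem eq_of_smul_eq_smul {s t : (cov.monodromyPerm b).range} {f : GaloisClosure π b}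
    (h : s • f = t • f) : s = t :=
  Subtype.ext <| inv_injective <| Equiv.ext fun a =>
    injective_eval cov f (congrArg (eval a) h)

theorem exists_smul_eq (a : π ⁻¹' {b}) {f f' : GaloisClosure π b}
    (h : π (eval a f) = π (eval a f')) : ∃ s : (cov.monodromyPerm b).range, s • f = f' := by
  obtain ⟨m, hm⟩ : ∃ m, π (eval a f) = m := ⟨_, rfl⟩
  obtain ⟨α, rfl⟩ := exists_eq_ofPath cov f a hm
  obtain ⟨α', rfl⟩ := exists_eq_ofPath cov f' a (h.symm.trans hm)
  let g : FundamentalGroup B b := α'.trans α.symm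
  have hg (a' : π ⁻¹' {b}) : cov.monodromy α (cov.monodromyPerm b g a') = cov.monodromy α' a' := by
    rw [cov.coe_monodromyPerm]
    change cov.monodromy α (cov.monodromy (α'.trans α.symm) a') = _
    rw [← cov.monodromy_trans_apply, Path.Homotopic.Quotient.trans_assoc,
      Path.Homotopic.Quotient.symm_trans, Path.Homotopic.Quotient.trans_refl]
  refine ⟨(cov.monodromyPerm b).rangeRestrict g⁻¹, ext fun a' => ?_⟩
  rw [eval_smul, MonoidHom.coe_rangeRestrict, map_inv, inv_inv, eval_ofPath, hg, eval_ofPath]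

theorem range_mapOfEq_comp_eval (a : π ⁻¹' {b}) (cov' : IsCoveringMap (π.comp (eval a)))
    (h : π.comp (eval a) (base π b) = b) :
    (FundamentalGroup.mapOfEq (π.comp (eval a)) h).range = (cov.monodromyPerm b).ker := by
  have eval_monodromy (g : FundamentalGroup B b) (a' : π ⁻¹' {b}) :
      eval a' (cov'.monodromy g ⟨base π b, h⟩ : GaloisClosure π b) = cov.monodromy g a' :=
    map_monodromy_eq_monodromy cov cov' (eval a') (fun e => proj_eval a' a e) g rfl
  ext g
  rw [mem_range_mapOfEq_iff_monodromy_eq cov' h, MonoidHom.mem_ker]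
  constructor
  · intro hg
    ext1 a'
    refine Subtype.ext ?_
    rw [cov.coe_monodromyPerm, ← eval_monodromy g a', hg]
    rfl
  · intro hg
    refine Subtype.ext (ext fun a' => (eval_monodromy g a').trans ?_)
    rw [← cov.coe_monodromyPerm, hg]
    rfl

end Monodromy

section Map

variable {M' : Type u} [TopologicalSpace M'] {π' : C(M', B)} (p : C(M', M))
  (hp : ∀ y, π (p y) = π' y)

/-- The map induced by a map over the base on the fibres over `b`. -/
def fibreMap (a : π' ⁻¹' {b}) : π ⁻¹' {b} :=
  ⟨p a, (hp a).trans a.2⟩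

variable {p} in
theorem surjective_fibreMap (hs : Function.Surjective p) :
    Function.Surjective (fibreMap (b := b) p hp) := by
  rintro ⟨a, ha⟩
  obtain ⟨a', rfl⟩ := hs a
  exact ⟨⟨a', (hp a').symm.trans ha⟩, rfl⟩

/-- The map of Galois closures induced by a surjective map `p` over the base. The tuple `p ∘ f` is
constant on the fibres of `p`, so its reindexing by the fibre of `π` may be computed on any section
of the map of the fibres; see `eval_map`. -/
noncomputable def map (hs : Function.Surjective p) :
    C(GaloisClosure π' b, GaloisClosure π b) :=
  let sec := Function.surjInv (surjective_fibreMap (b := b) hp hs)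
  let p' (f : FibreTuple π' b) : FibreTuple π b :=
    ⟨fun a => p (f.1 (sec a)), fun _ _ => by rw [hp, hp, f.2]⟩
  have hp' : Continuous p' :=
    (continuous_pi fun a => p.continuous.comp (FibreTuple.continuous_eval (sec a))).subtype_mk _
  have hbase : p' (FibreTuple.inclusion π' b) = FibreTuple.inclusion π b :=
    Subtype.ext <| funext fun a => congrArg Subtype.val <|
      Function.surjInv_eq (surjective_fibreMap (b := b) hp hs) a
  ⟨fun f => ⟨p' f.1, hbase ▸ f.2.map hp'⟩, (hp'.comp continuous_subtype_val).subtype_mk _⟩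

variable {p} (cov : IsCoveringMap π) (cov' : IsCoveringMap π') (hs : Function.Surjective p)
include cov cov'

theorem eval_map (f : GaloisClosure π' b) (a : π' ⁻¹' {b}) :
    eval (fibreMap p hp a) (map p hp hs f) = p (eval a f) := by
  obtain ⟨m, hm⟩ : ∃ m, π' (eval a f) = m := ⟨_, rfl⟩
  obtain ⟨α, rfl⟩ := exists_eq_ofPath cov' f a hm
  change p (cov'.monodromy α (Function.surjInv (surjective_fibreMap hp hs) (fibreMap p hp a))) =
    p (cov'.monodromy α a)
  have hsec := congrArg Subtype.val <|
    Function.surjInv_eq (surjective_fibreMap hp hs) (fibreMap p hp a)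
  rw [map_monodromy_eq_monodromy cov cov' p hp α hsec,
    map_monodromy_eq_monodromy cov cov' p hp α (e := fibreMap p hp a) rfl]

theorem map_base : map p hp hs (base π' b) = base π b := by
  ext a
  obtain ⟨a, rfl⟩ := surjective_fibreMap hp hs a
  exact eval_map hp cov cov' hs _ a

theorem map_smul (g : FundamentalGroup B b) (f : GaloisClosure π' b) :
    map p hp hs ((cov'.monodromyPerm b).rangeRestrict g • f) =
      (cov.monodromyPerm b).rangeRestrict g • map p hp hs f := by
  have hinv (a : π' ⁻¹' {b}) : fibreMap p hp ((cov'.monodromyPerm b g)⁻¹ a) =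
      (cov.monodromyPerm b g)⁻¹ (fibreMap p hp a) := by
    rw [← map_inv, ← map_inv]
    exact Subtype.ext (map_monodromy_eq_monodromy cov cov' p hp (g⁻¹ : FundamentalGroup B b) rfl)
  ext a
  obtain ⟨a, rfl⟩ := surjective_fibreMap hp hs a
  rw [eval_map hp cov cov', eval_smul, eval_smul, MonoidHom.coe_rangeRestrict,
    MonoidHom.coe_rangeRestrict, ← hinv, eval_map hp cov cov']

end Map

end GaloisClosure

end FibreTuple

/-! ### Towers of coverings -/

section CoveringMap

variable {X Y B : Type u} [TopologicalSpace X] [TopologicalSpace Y] [TopologicalSpace B]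

namespace IsUniqueFibration

theorem of_isCoveringMap {π : X → B} (cov : IsCoveringMap π) : IsUniqueFibration π where
  continuous := cov.continuous
  exists_lift H f h0 := ⟨cov.liftHomotopy H f h0, congrFun (cov.liftHomotopy_lifts H f h0),
    cov.liftHomotopy_zero H f h0⟩
  path_unique γ γ' h h0 := DFunLike.ext' <|
    cov.eq_of_comp_eq γ.continuous γ'.continuous (funext h) 0 h0

theorem of_homeomorph (h : X ≃ₜ Y) : IsUniqueFibration h where
  continuous := h.continuous
  exists_lift H f h0 := ⟨⟨fun z => h.symm (H z), by fun_prop⟩, fun z => by simp,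
    fun a => by simp [h0]⟩
  path_unique γ γ' h' _ := ContinuousMap.ext fun t => h.injective (h' t)

theorem comp {π : Y → B} {q : X → Y} (hπ : IsUniqueFibration π) (hq : IsUniqueFibration q) :
    IsUniqueFibration (π ∘ q) where
  continuous := hπ.continuous.comp hq.continuous
  exists_lift H f h0 := by
    obtain ⟨H', hH', h0'⟩ := hπ.exists_lift H ((⟨q, hq.continuous⟩ : C(X, Y)).comp f) h0
    obtain ⟨H'', hH'', h0''⟩ := hq.exists_lift H' f h0'
    exact ⟨H'', fun z => by rw [Function.comp_apply, hH'', hH'], h0''⟩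
  path_unique γ γ' h h0 := by
    let k : C(X, Y) := ⟨q, hq.continuous⟩
    have hqγ := hπ.path_unique (k.comp γ) (k.comp γ') h (congrArg q h0)
    exact hq.path_unique γ γ' (DFunLike.congr_fun hqγ) h0

end IsUniqueFibration

theorem surjective_of_isCoveringMap [CompactSpace X] [Nonempty X] [T2Space Y]
    [PreconnectedSpace Y] {p : X → Y} (cov : IsCoveringMap p) : Function.Surjective p := by
  rw [← range_eq_univ]
  exact IsClopen.eq_univ ⟨(isCompact_range cov.continuous).isClosed, cov.isOpenMap.isOpen_range⟩
    (range_nonempty p)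

theorem finite_fibre_of_isCoveringMap [CompactSpace X] [T1Space Y] {p : X → Y}
    (cov : IsCoveringMap p) (y : Y) : Finite (p ⁻¹' {y}) := by
  have := (cov y).discreteTopology_fiber
  have : CompactSpace (p ⁻¹' {y}) :=
    isCompact_iff_compactSpace.1 (isClosed_singleton.preimage cov.continuous).isCompact
  exact finite_of_compact_of_discrete

end CoveringMap

namespace CoveringTower

variable {n : ℕ} (P : CoveringTower.{u} n)

instance (l : ℕ) : CompactSpace (P.M l) := (P.isClosedManifold l).compactSpace

instance (l : ℕ) : ConnectedSpace (P.M l) := (P.isClosedManifold l).connectedSpace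

instance (l : ℕ) : T2Space (P.M l) := (P.isClosedManifold l).t2Space

noncomputable instance chartedSpace (l : ℕ) :
    ChartedSpace (EuclideanSpace ℝ (Fin n)) (P.M l) :=
  (P.isClosedManifold l).chartedSpace.some

instance (l : ℕ) : LocallyPathConnectedSpace (P.M l) :=
  ChartedSpace.locallyPathConnectedSpace (EuclideanSpace ℝ (Fin n)) (P.M l)

instance (l : ℕ) : PathConnectedSpace (P.M l) :=
  pathConnectedSpace_iff_connectedSpace.2 inferInstance

instance (l : ℕ) : SecondCountableTopology (P.M l) :=
  ChartedSpace.secondCountable_of_sigmaCompact (EuclideanSpace ℝ (Fin n)) (P.M l)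

instance : T2Space P.Limit :=
  inferInstanceAs (T2Space {x : ∀ l, P.M l // ∀ l, P.p l (x (l + 1)) = x l})

instance : SecondCountableTopology P.Limit :=
  inferInstanceAs (SecondCountableTopology ↥{x : ∀ l, P.M l | ∀ l, P.p l (x (l + 1)) = x l})

instance : CompactSpace P.Limit := by
  refine isCompact_iff_compactSpace.1 (IsClosed.isCompact
    (s := {x : ∀ l, P.M l | ∀ l, P.p l (x (l + 1)) = x l}) ?_)
  rw [ofPred_forall]
  exact isClosed_iInter fun l => isClosed_eq (by fun_prop) (by fun_prop)

instance : MetrizableSpace P.Limit :=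
  metrizableSpace_of_t3_secondCountable _

variable {P} in
theorem continuous_coord (l : ℕ) : Continuous fun x : P.Limit => x.coord l :=
  (continuous_apply l).comp continuous_subtype_val

variable {P} in
theorem Limit.ext {x y : P.Limit} (h : ∀ l, x.coord l = y.coord l) : x = y :=
  Subtype.ext (funext h)

theorem p_coord (x : P.Limit) (l : ℕ) : P.p l (x.coord (l + 1)) = x.coord l :=
  x.2 l

theorem surjective_p (l : ℕ) : Function.Surjective (P.p l) :=
  surjective_of_isCoveringMap (P.isCoveringMap l)

theorem isLocalHomeomorph_q (l : ℕ) : IsLocalHomeomorph (P.q l) := by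
  induction l with
  | zero => exact (Homeomorph.refl (P.M 0)).isLocalHomeomorph
  | succ l ih => exact ih.comp (P.isCoveringMap l).isLocalHomeomorph

theorem isCoveringMap_q (l : ℕ) : IsCoveringMap (P.q l) :=
  isLocalHomeomorph_iff_isCoveringMap.1 (P.isLocalHomeomorph_q l)

variable {P} in
theorem eq_coord_comp_of_q_comp_eq {A : Type*} [TopologicalSpace A] [PreconnectedSpace A]
    {l : ℕ} {f : A → P.M l} {g : A → P.Limit} (hf : Continuous f) (hg : Continuous g)
    (h : ∀ a, P.q l (f a) = (g a).coord 0) (a₀ : A) (h₀ : f a₀ = (g a₀).coord l) (a : A) :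
    f a = (g a).coord l :=
  congrFun ((P.isCoveringMap_q l).eq_of_comp_eq hf ((continuous_coord l).comp hg)
    (funext fun a => (h a).trans (P.q_coord _ l).symm) a₀ h₀) a

theorem isUniqueFibration_coord_zero : IsUniqueFibration fun x : P.Limit => x.coord 0 where
  continuous := continuous_coord 0
  exists_lift {A} _ H f h0 := by
    have h0' (l : ℕ) (a : A) : H (0, a) = P.q l ((f a).coord l) := by rw [P.q_coord, h0]
    let c (l : ℕ) : C(A, P.M l) := ⟨fun a => (f a).coord l, (continuous_coord l).comp f.continuous⟩
    let H' (l : ℕ) : C(I × A, P.M l) := (P.isCoveringMap_q l).liftHomotopy H (c l) (h0' l)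
    have q_H' (l : ℕ) (z : I × A) : P.q l (H' l z) = H z :=
      congrFun ((P.isCoveringMap_q l).liftHomotopy_lifts H (c l) (h0' l)) z
    have H'_zero (l : ℕ) (a : A) : H' l (0, a) = (f a).coord l :=
      (P.isCoveringMap_q l).liftHomotopy_zero H (c l) (h0' l) a
    have p_H' (l : ℕ) : (P.p l).comp (H' (l + 1)) = H' l :=
      ((P.isCoveringMap_q l).eq_liftHomotopy_iff' (h0' l) _).2 ⟨funext (q_H' (l + 1)), fun a =>
        (congrArg (P.p l) (H'_zero (l + 1) a)).trans (P.p_coord (f a) l)⟩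
    exact ⟨⟨fun z => ⟨fun l => H' l z, fun l => DFunLike.congr_fun (p_H' l) z⟩,
      (continuous_pi fun l => (H' l).continuous).subtype_mk _⟩, q_H' 0,
      fun a => Limit.ext fun l => H'_zero l a⟩
  path_unique γ γ' h h0 := by
    ext t
    exact Limit.ext fun l => eq_coord_comp_of_q_comp_eq ((continuous_coord l).comp γ.continuous)
      γ'.continuous (fun t => (P.q_coord _ l).trans (h t)) 0 (congrArg (·.coord l) h0) t

theorem exists_mem_pathComponent_coord_eq (z w : P.Limit) (l : ℕ) :
    ∃ w' ∈ pathComponent z, w'.coord l = w.coord l := by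
  let β := PathConnectedSpace.somePath (z.coord l) (w.coord l)
  obtain ⟨Γ, hΓ, hΓ0⟩ := P.isUniqueFibration_coord_zero.exists_path_lift
    ((P.q l).comp β) z (by simp [P.q_coord])
  refine ⟨Γ 1, ⟨⟨Γ, hΓ0, rfl⟩⟩, ?_⟩
  have hβ : β 1 = (Γ 1).coord l := eq_coord_comp_of_q_comp_eq β.continuous Γ.continuous
    (fun t => (hΓ t).symm) 0 (by rw [β.source, hΓ0]) 1
  exact hβ.symm.trans β.target

theorem coord_eq_of_le {w w' : P.Limit} {l : ℕ} (h : w.coord l = w'.coord l) {i : ℕ}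
    (hi : i ≤ l) : w.coord i = w'.coord i := by
  induction l, hi using Nat.le_induction with
  | base => exact h
  | succ l _ ih => exact ih (by rw [← P.p_coord w, ← P.p_coord w', h])

theorem exists_forall_coord_eq_imp_mem (w : P.Limit) {O : Set P.Limit} (hO : IsOpen O)
    (hw : w ∈ O) : ∃ l, ∀ w' : P.Limit, w'.coord l = w.coord l → w' ∈ O := by
  obtain ⟨O', hO', rfl⟩ := isOpen_induced_iff.1 hO
  obtain ⟨F, U, hU, hUO⟩ := isOpen_pi_iff.1 hO' w.1 hw
  refine ⟨F.sup id, fun w' h => hUO fun i hi => ?_⟩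
  have hi' : w'.1 i = w.1 i := P.coord_eq_of_le h (Finset.le_sup (f := id) hi)
  exact hi' ▸ (hU i hi).2

theorem dense_pathComponent (z : P.Limit) : Dense (pathComponent z) := by
  rw [dense_iff_inter_open]
  rintro O hO ⟨w, hw⟩
  obtain ⟨l, hl⟩ := P.exists_forall_coord_eq_imp_mem w hO hw
  obtain ⟨w', hw', h⟩ := P.exists_mem_pathComponent_coord_eq z w l
  exact ⟨w', hl w' h, hw'⟩

theorem connectedSpace_limit (z : P.Limit) : ConnectedSpace P.Limit where
  isPreconnected_univ := by
    rw [← (P.dense_pathComponent z).closure_eq]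
    exact isPathConnected_pathComponent.isConnected.isPreconnected.closure
  toNonempty := ⟨z⟩

/-! ### The tower of the Galois closures -/

variable (x : P.Limit)

theorem normalCore_groupChain (l : ℕ) :
    (P.groupChain x l).normalCore = ((P.isCoveringMap_q l).monodromyPerm (x.coord 0)).ker :=
  normalCore_range_mapOfEq_eq_ker_monodromyPerm (P.isCoveringMap_q l) (P.q_coord x l)

instance (l : ℕ) : Finite (P.q l ⁻¹' {x.coord 0}) :=
  finite_fibre_of_isCoveringMap (P.isCoveringMap_q l) _

/-- The `l`-th coordinate of the base point, as a point of the fibre of `P.q l`. -/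
def fibrePoint (l : ℕ) : P.q l ⁻¹' {x.coord 0} :=
  ⟨x.coord l, P.q_coord x l⟩

/-- The projection of the Galois closure of `P.q l` to `P.M l`. -/
def galoisProj (l : ℕ) : C(GaloisClosure (P.q l) (x.coord 0), P.M l) :=
  GaloisClosure.eval (P.fibrePoint x l)

theorem isLocalHomeomorph_q_comp_galoisProj (l : ℕ) :
    IsLocalHomeomorph ((P.q l).comp (P.galoisProj x l)) :=
  GaloisClosure.isLocalHomeomorph_comp_eval (P.isLocalHomeomorph_q l) (P.fibrePoint x l)

/-- The map between successive Galois closures induced by the bonding map `P.p l`. -/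
noncomputable def galoisMap (l : ℕ) :
    C(GaloisClosure (P.q (l + 1)) (x.coord 0), GaloisClosure (P.q l) (x.coord 0)) :=
  GaloisClosure.map (P.p l) (fun _ => rfl) (P.surjective_p l)

theorem galoisProj_galoisMap (l : ℕ) (f : GaloisClosure (P.q (l + 1)) (x.coord 0)) :
    P.galoisProj x l (P.galoisMap x l f) = P.p l (P.galoisProj x (l + 1) f) := by
  have h : P.fibrePoint x l =
      GaloisClosure.fibreMap (P.p l) (fun _ => rfl) (P.fibrePoint x (l + 1)) :=
    Subtype.ext (P.p_coord x l).symm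
  rw [galoisProj, h]
  exact GaloisClosure.eval_map _ (P.isCoveringMap_q l) (P.isCoveringMap_q (l + 1)) _ f _

/-- The tower of the Galois closures of the coverings `P.q l`, whose limit is the Molino space. -/
noncomputable def galoisTower : CoveringTower.{u} n where
  M l := GaloisClosure (P.q l) (x.coord 0)
  isClosedManifold l :=
    { compactSpace := GaloisClosure.compactSpace (P.isLocalHomeomorph_q l) (P.fibrePoint x l)
      connectedSpace := inferInstance
      t2Space := inferInstance
      chartedSpace := ⟨chartedSpaceOfIsLocalHomeomorph
        (P.isLocalHomeomorph_q_comp_galoisProj x l)⟩ }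
  p := P.galoisMap x
  isCoveringMap l := by
    have := GaloisClosure.compactSpace (P.isLocalHomeomorph_q (l + 1)) (P.fibrePoint x (l + 1))
    rw [← isLocalHomeomorph_iff_isCoveringMap]
    refine IsLocalHomeomorph.of_comp (g := (P.q l).comp (P.galoisProj x l)) ?_
      (P.isLocalHomeomorph_q_comp_galoisProj x l) (P.galoisMap x l).continuous
    convert P.isLocalHomeomorph_q_comp_galoisProj x (l + 1) using 1
    ext f
    exact congrArg (P.q l) (P.galoisProj_galoisMap x l f)

/-- The base point of the limit of the Galois closures. -/
noncomputable def galoisBase : (P.galoisTower x).Limit :=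
  ⟨fun l => GaloisClosure.base (P.q l) (x.coord 0), fun l =>
    GaloisClosure.map_base _ (P.isCoveringMap_q l) (P.isCoveringMap_q (l + 1)) (P.surjective_p l)⟩

theorem isCoveringMap_q_comp_galoisProj (l : ℕ) :
    IsCoveringMap ((P.q l).comp (P.galoisProj x l)) :=
  isLocalHomeomorph_iff_isCoveringMap (E := (P.galoisTower x).M l).1
    (P.isLocalHomeomorph_q_comp_galoisProj x l)

theorem isCoveringMap_galoisProj (l : ℕ) : IsCoveringMap (P.galoisProj x l) :=
  isLocalHomeomorph_iff_isCoveringMap (E := (P.galoisTower x).M l).1 <|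
    IsLocalHomeomorph.of_comp (g := P.q l) (P.isLocalHomeomorph_q_comp_galoisProj x l)
      (P.isLocalHomeomorph_q l) (P.galoisProj x l).continuous

theorem isCoreTower_galoisTower :
    IsCoreTower P x (P.galoisTower x) (P.galoisBase x) (P.galoisProj x) where
  isCoveringMap := P.isCoveringMap_galoisProj x
  comm := P.galoisProj_galoisMap x
  base _ := rfl
  range_eq l := by
    rw [normalCore_groupChain]
    exact GaloisClosure.range_mapOfEq_comp_eval (P.isCoveringMap_q l) (P.fibrePoint x l)
      (P.isCoveringMap_q_comp_galoisProj x l) _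

end CoveringTower

/-! ### The topology of the discriminant group -/

namespace Discriminant

variable {Γ : Type u} [Group Γ] (G : ℕ → Subgroup Γ)

instance : IsTopologicalGroup (Discriminant G) :=
  letI (l : ℕ) : TopologicalSpace (Γ ⧸ (G l).normalCore) := ⊥
  haveI (l : ℕ) : DiscreteTopology (Γ ⧸ (G l).normalCore) := ⟨rfl⟩
  inferInstanceAs (IsTopologicalGroup (discriminantSubgroup G))

instance : T2Space (Discriminant G) :=
  letI (l : ℕ) : TopologicalSpace (Γ ⧸ (G l).normalCore) := ⊥
  haveI (l : ℕ) : DiscreteTopology (Γ ⧸ (G l).normalCore) := ⟨rfl⟩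
  inferInstanceAs (T2Space (discriminantSubgroup G))

instance : TotallyDisconnectedSpace (Discriminant G) :=
  letI (l : ℕ) : TopologicalSpace (Γ ⧸ (G l).normalCore) := ⊥
  haveI (l : ℕ) : DiscreteTopology (Γ ⧸ (G l).normalCore) := ⟨rfl⟩
  inferInstanceAs (TotallyDisconnectedSpace (discriminantSubgroup G))

instance compactSpace [∀ l, Finite (Γ ⧸ (G l).normalCore)] : CompactSpace (Discriminant G) := by
  let (l : ℕ) : TopologicalSpace (Γ ⧸ (G l).normalCore) := ⊥
  have (l : ℕ) : DiscreteTopology (Γ ⧸ (G l).normalCore) := ⟨rfl⟩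
  have hcore : (coreLimit G : Set (∀ l, Γ ⧸ (G l).normalCore)) =
      ⋂ l, (fun c : ∀ l, Γ ⧸ (G l).normalCore => (c (l + 1), c l)) ⁻¹'
        {c | ∃ g : Γ, c.1 = g ∧ c.2 = g} := by
    ext c
    rw [mem_iInter]
    rfl
  have hcore' : IsClosed (coreLimit G : Set (∀ l, Γ ⧸ (G l).normalCore)) :=
    hcore ▸ isClosed_iInter fun l => (isClosed_discrete _).preimage (by fun_prop)
  have h : IsClosed (discriminantSubgroup G : Set (∀ l, Γ ⧸ (G l).normalCore)) :=
    hcore'.inter (isClosed_set_pi fun l _ => isClosed_discrete _)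
  exact isCompact_iff_compactSpace.1 h.isCompact

variable {G}

/-- The inclusion of the discriminant group in the inverse limit of the quotients by the cores. -/
def toCoreLimit : Discriminant G →* coreLimit G :=
  Subgroup.inclusion inf_le_left

theorem isOpen_setOf_coord_eq (l : ℕ) (c : Γ ⧸ (G l).normalCore) :
    IsOpen {d : Discriminant G | (toCoreLimit d).1 l = c} := by
  let (l : ℕ) : TopologicalSpace (Γ ⧸ (G l).normalCore) := ⊥
  have (l : ℕ) : DiscreteTopology (Γ ⧸ (G l).normalCore) := ⟨rfl⟩
  have h : Continuous fun d : discriminantSubgroup G => d.1 l :=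
    (continuous_apply l).comp continuous_subtype_val
  exact (isOpen_discrete {c}).preimage h

end Discriminant

namespace CoveringTower

variable {n : ℕ} (P : CoveringTower.{u} n) (x : P.Limit)

/-! ### The deck transformations of the tower of the Galois closures -/

/-- The quotient of the fundamental group by the `l`-th core, which is the group of deck
transformations of the `l`-th manifold of `P.galoisTower x` over `P.M 0`. -/
abbrev DeckGroup (l : ℕ) : Type u :=
  FundamentalGroup (P.M 0) (x.coord 0) ⧸ (P.groupChain x l).normalCore

/-- The quotient by the `l`-th core as a group of permutations of the fibre of `P.q l`. -/
noncomputable def deckGroupEquiv (l : ℕ) :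
    P.DeckGroup x l ≃* ((P.isCoveringMap_q l).monodromyPerm (x.coord 0)).range :=
  (QuotientGroup.quotientMulEquivOfEq (P.normalCore_groupChain x l)).trans
    (QuotientGroup.quotientKerEquivRange _)

instance (l : ℕ) : Finite (P.DeckGroup x l) :=
  .of_equiv _ (P.deckGroupEquiv x l).symm.toEquiv

noncomputable instance (l : ℕ) : MulAction (P.DeckGroup x l) ((P.galoisTower x).M l) :=
  MulAction.compHom (GaloisClosure (P.q l) (x.coord 0)) (P.deckGroupEquiv x l).toMonoidHom

instance (l : ℕ) : ContinuousConstSMul (P.DeckGroup x l) ((P.galoisTower x).M l) where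
  continuous_const_smul c :=
    continuous_const_smul (T := GaloisClosure (P.q l) (x.coord 0)) (P.deckGroupEquiv x l c)

theorem eq_of_deckGroup_smul_eq_smul {l : ℕ} {c c' : P.DeckGroup x l}
    {f : (P.galoisTower x).M l} (h : c • f = c' • f) : c = c' :=
  (P.deckGroupEquiv x l).injective (GaloisClosure.eq_of_smul_eq_smul (P.isCoveringMap_q l) h)

theorem exists_deckGroup_smul_eq {l : ℕ} {f f' : (P.galoisTower x).M l}
    (h : P.q l (P.galoisProj x l f) = P.q l (P.galoisProj x l f')) :
    ∃ c : P.DeckGroup x l, c • f = f' := by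
  obtain ⟨s, hs⟩ := GaloisClosure.exists_smul_eq (P.isCoveringMap_q l) (P.fibrePoint x l) h
  obtain ⟨c, rfl⟩ := (P.deckGroupEquiv x l).surjective s
  exact ⟨c, hs⟩

theorem galoisProj_smul_eq_iff {l : ℕ} (c : P.DeckGroup x l) (f : (P.galoisTower x).M l) :
    P.galoisProj x l (c • f) = P.galoisProj x l f ↔
      c ∈ (P.groupChain x l).map (QuotientGroup.mk' (P.groupChain x l).normalCore) := by
  obtain ⟨g, rfl⟩ := QuotientGroup.mk_surjective c
  have hcore : (QuotientGroup.mk' (P.groupChain x l).normalCore).ker ≤ P.groupChain x l := by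
    rw [QuotientGroup.ker_mk']
    exact Subgroup.normalCore_le _
  have hmem : (g : P.DeckGroup x l) ∈
      (P.groupChain x l).map (QuotientGroup.mk' (P.groupChain x l).normalCore) ↔
        g ∈ P.groupChain x l := by
    rw [← QuotientGroup.mk'_apply, ← Subgroup.mem_comap, Subgroup.comap_map_eq_self hcore]
  rw [hmem]
  exact (GaloisClosure.eval_smul_eq_iff (P.isCoveringMap_q l) (P.deckGroupEquiv x l g) f
    (P.fibrePoint x l)).trans
      (mem_range_mapOfEq_iff_monodromy_eq (P.isCoveringMap_q l) (P.q_coord x l) g).symm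

theorem p_galoisTower_smul (l : ℕ) (g : FundamentalGroup (P.M 0) (x.coord 0))
    (f : (P.galoisTower x).M (l + 1)) :
    (P.galoisTower x).p l ((g : P.DeckGroup x (l + 1)) • f) =
      (g : P.DeckGroup x l) • (P.galoisTower x).p l f :=
  GaloisClosure.map_smul _ (P.isCoveringMap_q l) (P.isCoveringMap_q (l + 1)) (P.surjective_p l) g f

/-! ### The Molino space -/

noncomputable instance : MulAction (coreLimit (P.groupChain x)) (P.galoisTower x).Limit where
  smul c w := ⟨fun l => c.1 l • w.coord l, fun l => by
    obtain ⟨g, hg', hg⟩ := c.2 l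
    beta_reduce
    rw [hg', hg, p_galoisTower_smul, p_coord]⟩
  one_smul w := Limit.ext fun l => one_smul (P.DeckGroup x l) (w.coord l)
  mul_smul c c' w := Limit.ext fun l => mul_smul (c.1 l) (c'.1 l) (w.coord l)

instance : ContinuousConstSMul (coreLimit (P.groupChain x)) (P.galoisTower x).Limit where
  continuous_const_smul c := (continuous_pi fun l =>
    (continuous_coord l).const_smul (c.1 l)).subtype_mk _

noncomputable instance : MulAction (Discriminant (P.groupChain x)) (P.galoisTower x).Limit :=
  MulAction.compHom _ Discriminant.toCoreLimit

instance : ContinuousSMul (Discriminant (P.groupChain x)) (P.galoisTower x).Limit where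
  continuous_smul := by
    refine (continuous_pi fun l => continuous_iff_continuousAt.2 ?_).subtype_mk _
    rintro ⟨d, w⟩
    let c := (Discriminant.toCoreLimit d).1 l
    have hd : ∀ᶠ z : Discriminant (P.groupChain x) × (P.galoisTower x).Limit in 𝓝 (d, w),
        (Discriminant.toCoreLimit z.1).1 l = c :=
      ((Discriminant.isOpen_setOf_coord_eq l c).preimage continuous_fst).mem_nhds
        (x := (d, w)) rfl
    have hc : Continuous fun z : Discriminant (P.groupChain x) × (P.galoisTower x).Limit =>
        c • z.2.coord l :=
      ((continuous_coord l).comp continuous_snd).const_smul c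
    refine hc.continuousAt.congr ?_
    filter_upwards [hd] with z hz
    rw [← hz]

/-- The limit of the projections of the Galois closures: the projection of the Molino space to the
weak solenoid. -/
noncomputable def galoisLimitMap : C((P.galoisTower x).Limit, P.Limit) where
  toFun w := ⟨fun l => P.galoisProj x l (w.coord l), fun l =>
    (P.galoisProj_galoisMap x l (w.coord (l + 1))).symm.trans
      (congrArg (P.galoisProj x l) ((P.galoisTower x).p_coord w l))⟩
  continuous_toFun := (continuous_pi fun l =>
    (P.galoisProj x l).continuous.comp (continuous_coord l)).subtype_mk _

theorem isUniqueFibration_galoisLimitMap_coord_zero :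
    IsUniqueFibration fun w => (P.galoisLimitMap x w).coord 0 :=
  (IsUniqueFibration.of_isCoveringMap (P.isCoveringMap_galoisProj x 0)).comp
    (P.galoisTower x).isUniqueFibration_coord_zero

theorem eq_of_smul_eq_smul {c c' : coreLimit (P.groupChain x)} {w : (P.galoisTower x).Limit}
    (h : c • w = c' • w) : c = c' :=
  Subtype.ext <| funext fun l => P.eq_of_deckGroup_smul_eq_smul x (congrArg (·.coord l) h)

theorem exists_smul_eq_of_coord_zero_eq {w w' : (P.galoisTower x).Limit}
    (h : (P.galoisLimitMap x w).coord 0 = (P.galoisLimitMap x w').coord 0) :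
    ∃ c : coreLimit (P.groupChain x), c • w = w' := by
  have hl (l : ℕ) : ∃ g : FundamentalGroup (P.M 0) (x.coord 0),
      (g : P.DeckGroup x l) • w.coord l = w'.coord l := by
    rw [← P.q_coord (P.galoisLimitMap x w) l, ← P.q_coord (P.galoisLimitMap x w') l] at h
    obtain ⟨c, hc⟩ := P.exists_deckGroup_smul_eq x h
    obtain ⟨g, rfl⟩ := QuotientGroup.mk_surjective c
    exact ⟨g, hc⟩
  choose g hg using hl
  have hcompat (l : ℕ) : (g l : P.DeckGroup x l) = g (l + 1) := by
    refine P.eq_of_deckGroup_smul_eq_smul x (f := w.coord l) ?_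
    rw [hg l, ← p_coord, ← hg (l + 1), p_galoisTower_smul, p_coord]
  exact ⟨⟨fun l => g l, fun l => ⟨g (l + 1), rfl, hcompat l⟩⟩, Limit.ext hg⟩

theorem galoisLimitMap_eq_iff (w w' : (P.galoisTower x).Limit) :
    P.galoisLimitMap x w = P.galoisLimitMap x w' ↔
      ∃ d : Discriminant (P.groupChain x), d • w = w' := by
  constructor
  · intro h
    obtain ⟨c, rfl⟩ := P.exists_smul_eq_of_coord_zero_eq x (congrArg (·.coord 0) h)
    exact ⟨⟨c.1, c.2, fun l _ =>
      (P.galoisProj_smul_eq_iff x (c.1 l) (w.coord l)).1 (congrArg (·.coord l) h.symm)⟩, rfl⟩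
  · rintro ⟨d, rfl⟩
    exact Limit.ext fun l =>
      ((P.galoisProj_smul_eq_iff x (d.1 l) (w.coord l)).2 (d.2.2 l trivial)).symm

theorem surjective_galoisLimitMap : Function.Surjective (P.galoisLimitMap x) := by
  have hdense : Dense (range (P.galoisLimitMap x)) :=
    (P.dense_pathComponent (P.galoisLimitMap x (P.galoisBase x))).mono fun y hy => by
      obtain ⟨w, hw⟩ := (P.isUniqueFibration_galoisLimitMap_coord_zero x).surjective_leafMap
        P.isUniqueFibration_coord_zero (fun _ => rfl) (P.galoisBase x) ⟨y, hy⟩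
      exact ⟨w.1, congrArg Subtype.val hw⟩
  rw [← range_eq_univ, ← hdense.closure_eq]
  exact (isCompact_range (P.galoisLimitMap x).continuous).isClosed.closure_eq.symm

theorem isOpenMap_galoisLimitMap : IsOpenMap (P.galoisLimitMap x) :=
  isOpenMap_of_fibres_eq_orbits (D := Discriminant (P.groupChain x))
    (P.galoisLimitMap x).continuous (P.surjective_galoisLimitMap x) (P.galoisLimitMap_eq_iff x)

theorem totallyDisconnectedSpace_preimage_fibre (b : P.M 0) :
    TotallyDisconnectedSpace (P.galoisLimitMap x ⁻¹' {y | y.coord 0 = b}) := by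
  have (l : ℕ) : DiscreteTopology (((P.q l).comp (P.galoisProj x l)) ⁻¹' {b}) :=
    (P.isCoveringMap_q_comp_galoisProj x l b).discreteTopology_fiber
  let coords (w : P.galoisLimitMap x ⁻¹' {y | y.coord 0 = b}) (l : ℕ) :
      ((P.q l).comp (P.galoisProj x l)) ⁻¹' {b} :=
    ⟨w.1.coord l, (P.q_coord (P.galoisLimitMap x w.1) l).trans w.2⟩
  have hcont : Continuous coords := continuous_pi fun l =>
    ((continuous_coord l).comp continuous_subtype_val).subtype_mk _
  have hinj : Function.Injective coords := fun w w' h => Subtype.ext <| Limit.ext fun l =>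
    congrArg Subtype.val (congrFun h l)
  exact ⟨isTotallyDisconnected_of_image hcont.continuousOn hinj
    (isTotallyDisconnected_of_totallyDisconnectedSpace _)⟩

theorem exists_fibre_section (b : P.M 0) :
    ∃ s : C({y : P.Limit | y.coord 0 = b}, (P.galoisTower x).Limit),
      ∀ y, P.galoisLimitMap x (s y) = y := by
  let Y : Set P.Limit := {y | y.coord 0 = b}
  have hY : IsClosed Y := isClosed_singleton.preimage (continuous_coord 0)
  have := isCompact_iff_compactSpace.1 (hY.preimage (P.galoisLimitMap x).continuous).isCompact
  have := P.totallyDisconnectedSpace_preimage_fibre x b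
  obtain ⟨s, hs⟩ := exists_continuous_section_of_isOpenMap
    ((P.galoisLimitMap x).continuous.restrictPreimage (s := Y))
    ((P.isOpenMap_galoisLimitMap x).restrictPreimage Y)
    ((P.surjective_galoisLimitMap x).restrictPreimage Y)
  exact ⟨⟨fun y => (s y).1, by fun_prop⟩, fun y => congrArg Subtype.val (hs y)⟩

theorem exists_continuousOn_section (y : P.Limit) :
    ∃ V ∈ 𝓝 y, ∃ s : P.Limit → (P.galoisTower x).Limit,
      ContinuousOn s V ∧ ∀ v ∈ V, P.galoisLimitMap x (s v) = v := by
  obtain ⟨N, ⟨hN, hNc⟩, hyN, -⟩ :=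
    (isTopologicalBasis_contractible_of_chartedSpace (EuclideanSpace ℝ (Fin n))
      (P.M 0)).exists_subset_of_mem_open (mem_univ (y.coord 0)) isOpen_univ
  obtain ⟨S, hS⟩ := (P.isUniqueFibration_galoisLimitMap_coord_zero x).exists_section_preimage
    P.isUniqueFibration_coord_zero (P.galoisLimitMap x) (fun _ => rfl) (N := N)
    fun b _ => P.exists_fibre_section x b
  refine ⟨_, (hN.preimage (continuous_coord 0)).mem_nhds hyN,
    Function.extend Subtype.val S fun _ => P.galoisBase x, ?_, fun v hv => ?_⟩
  · rw [continuousOn_iff_continuous_domRestrict]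
    exact S.continuous.congr fun v => (Subtype.val_injective.extend_apply S _ v).symm
  · exact (congrArg _ (Subtype.val_injective.extend_apply S _ ⟨v, hv⟩)).trans (hS ⟨v, hv⟩)

theorem isPrincipalBundle_galoisLimitMap {Y : Type u} [TopologicalSpace Y] (h : Y ≃ₜ P.Limit) :
    IsPrincipalBundle (Discriminant (P.groupChain x)) (h.symm ∘ P.galoisLimitMap x) := by
  refine IsPrincipalBundle.of_local_sections (by fun_prop) (fun w w' => ?_)
    (fun d d' w hw => Subgroup.inclusion_injective _ (P.eq_of_smul_eq_smul x hw)) (fun y => ?_)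
  · rw [← galoisLimitMap_eq_iff]
    exact h.symm.injective.eq_iff
  · obtain ⟨V, hV, s, hs, hqs⟩ := P.exists_continuousOn_section x (h y)
    refine ⟨h ⁻¹' V, h.continuous.continuousAt.preimage_mem_nhds hV, s ∘ h,
      hs.comp h.continuous.continuousOn fun _ hv => hv, fun v hv => ?_⟩
    rw [Function.comp_apply, Function.comp_apply, hqs _ hv, h.symm_apply_apply]

theorem isHomogeneousSpace_limit_galoisTower : IsHomogeneousSpace (P.galoisTower x).Limit := by
  have := (P.galoisTower x).connectedSpace_limit (P.galoisBase x)
  refine (P.isUniqueFibration_galoisLimitMap_coord_zero x).isHomogeneousSpace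
    (exists_homotopy_moving_of_chartedSpace (EuclideanSpace ℝ (Fin n))) fun w w' h => ?_
  obtain ⟨c, hc⟩ := P.exists_smul_eq_of_coord_zero_eq x h
  exact ⟨Homeomorph.smul c, hc⟩

end CoveringTower

theorem mainTheorem1 {n : ℕ} {𝔐 : Type u} [TopologicalSpace 𝔐] (hM : IsMatchboxManifold n 𝔐)
    (P : Presentation.{u} n) (h : 𝔐 ≃ₜ P.Limit) (x : P.Limit) :
    (IsTopologicalGroup (Discriminant (P.groupChain x)) ∧
      CompactSpace (Discriminant (P.groupChain x)) ∧
      T2Space (Discriminant (P.groupChain x)) ∧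
      TotallyDisconnectedSpace (Discriminant (P.groupChain x))) ∧
    ∃ (Q : CoveringTower.{u} n) (z : Q.Limit) (r : ∀ l, C(Q.M l, P.M l)),
      IsCoreTower P.toCoveringTower x Q z r ∧
      IsMatchboxManifold n Q.Limit ∧
      IsHomogeneousSpace Q.Limit ∧
      ∃ qhat : C(Q.Limit, 𝔐),
        (∀ w l, (h (qhat w)).coord l = r l (w.coord l)) ∧
        (∃ _ : MulAction (Discriminant (P.groupChain x)) Q.Limit,
          IsPrincipalBundle (Discriminant (P.groupChain x)) qhat) ∧
        ∀ w : Q.Limit,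
          IsCoveringMap (leafMap qhat w) ∧ Function.Surjective (leafMap qhat w) := by
  obtain ⟨P, -⟩ := P
  let qhat : C((P.galoisTower x).Limit, 𝔐) := (h.symm : C(P.Limit, 𝔐)).comp (P.galoisLimitMap x)
  have h_qhat (w) : h (qhat w) = P.galoisLimitMap x w := h.apply_symm_apply _
  have hbundle : IsPrincipalBundle (Discriminant (P.groupChain x)) qhat :=
    P.isPrincipalBundle_galoisLimitMap x h
  have hconn := (P.galoisTower x).connectedSpace_limit (P.galoisBase x)
  have hmatchbox : IsMatchboxManifold n (P.galoisTower x).Limit :=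
    hM.of_trivialization fun y => (hbundle.exists_trivialization y).imp fun e he => he.1
  have hX := P.isUniqueFibration_galoisLimitMap_coord_zero x
  have hY := P.isUniqueFibration_coord_zero.comp (IsUniqueFibration.of_homeomorph h)
  have hXY (w) : (h (qhat w)).coord 0 = (P.galoisLimitMap x w).coord 0 := by rw [h_qhat]
  have hbasis := isTopologicalBasis_contractible_of_chartedSpace (EuclideanSpace ℝ (Fin n)) (P.M 0)
  exact ⟨⟨inferInstance, inferInstance, inferInstance, inferInstance⟩, P.galoisTower x,
    P.galoisBase x, P.galoisProj x, P.isCoreTower_galoisTower x, hmatchbox,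
    P.isHomogeneousSpace_limit_galoisTower x, qhat, fun w l => congrArg (·.coord l) (h_qhat w),
    ⟨inferInstance, hbundle⟩,
    fun w => ⟨hX.isCoveringMap_leafMap hY hbasis hXY w, hX.surjective_leafMap hY hXY w⟩⟩
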